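/- Regard $\mathbb S^3$ as the unit quaternions, write tangent vectors of $\mathbb S^3\times\mathbb S^3$ at $(p,q)$ as $Z=(U,V)$ with $U\in T_p\mathbb S^3$, $V\in T_q\mathbb S^3$, and set $$JZ=\tfrac1{\sqrt3}(2pq^{-1}V-U,\,-2qp^{-1}U+V),\qquad g(Z,Z')=\tfrac12\big(\langle Z,Z'\rangle+\langle JZ,JZ'\rangle\big),\qquad PZ=(pq^{-1}V,\,qp^{-1}U),$$ where $\langle\cdot,\cdot\rangle$ is the standard product metric. Then $(\mathbb S^3\times\mathbb S^3,g,J)$ is the homogeneous nearly Kähler $\mathbb S^3\times\mathbb S^3$. Let $\tilde\nabla$ be the Levi-Civita connection of $g$ and $G(X,Y)=(\tilde\nabla_XJ)Y$. Let $M$ be a smooth $3$-manifold, smoothly immersed in $\mathbb S^3\times\mathbb S^3$ as a Lagrangian submanifold, i.e. $JTM=T^\perp M$. Tangent vectors of $M$ are identified with their images, and $\nabla$, $\nabla^\perp$, $h$, $R$, $R^\perp$ denote the induced connection, the normal connection, the second fundamental form, and the curvature tensors of $\nabla$ and $\nabla^\perp$ (with $R(X,Y)=\nabla_X\nabla_Y-\nabla_Y\nabla_X-\nabla_{[X,Y]}$,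 and similarly for $R^\perp$); put $(\nabla h)(X,Y,Z)=\nabla^\perp_Xh(Y,Z)-h(\nabla_XY,Z)-h(Y,\nabla_XZ)$. Suppose that $M$ is $J$-isotropic: there is a function $\lambda:M\to\mathbb R$ with $$g((\nabla h)(v,v,v),Jv)=\lambda\,(g(v,v))^2\qquad\text{for all } v\in TM.$$ Then $\lambda$ is smooth, and for all tangent vectors $X,Y,Z,W,V$ of $M$ at the same point $$\begin{aligned} &12\,g\big(R^\perp(X,Y)h(Z,W)-h(R(X,Y)Z,W)-h(Z,R(X,Y)W),JV\big)\\ &+9\big[g((\nabla h)(Y,Z,W),G(X,V))-g((\nabla h)(X,Z,W),G(Y,V))\big]\\ &+3g(h(Y,Z),JW)g(X,V)-3g(h(X,Z),JW)g(Y,V)\\ &+\mathop{\mathfrak S}_{ZW}\Big[g(h(X,Z),JV)g(Y,W)-g(h(Y,Z),JV)g(X,W)\\ &\qquad+g(PY,Z)g(PX,G(W,V))-g(PX,Z)g(PY,G(W,V))\\ &\qquad+g(JPY,Z)g(JPX,G(W,V))-g(JPX,Z)g(JPY,G(W,V))\Big]\\ &+2\,\mathbf I(X,Y,Z,W,V)=0,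 \end{aligned}$$ where $$\begin{aligned} \mathbf I(X,Y,Z,W,V)=\mathop{\mathfrak S}_{ZWV}\Big[&g(PY,h(X,Z))g(PJW,V)+g((\tilde\nabla_XP)Y+Ph(X,Y),Z)g(PJW,V)\\ &+g(PY,Z)g(PJW,h(X,V))+g(PY,Z)g((\tilde\nabla_XPJ)W+PJh(X,W),V)\\ &-g(PX,h(Y,Z))g(PJW,V)-g((\tilde\nabla_YP)X+Ph(X,Y),Z)g(PJW,V)\\ &-g(PX,Z)g(PJW,h(Y,V))-g(PX,Z)g((\tilde\nabla_YPJ)W+PJh(Y,W),V)\\ &-g(PJY,h(X,Z))g(PW,V)-g((\tilde\nabla_XPJ)Y+PJh(X,Y),Z)g(PW,V)\\ &-g(PJY,Z)g(PW,h(X,V))-g(PJY,Z)g((\tilde\nabla_XP)W+Ph(X,W),V)\\ &+g(PJX,h(Y,Z))g(PW,V)+g((\tilde\nabla_YPJ)X+PJh(X,Y),Z)g(PW,V)\\ &+g(PJX,Z)g(PW,h(Y,V))+g(PJX,Z)g((\tilde\nabla_YP)W+Ph(Y,W),V)\\ &-2X(\lambda)g(Y,Z)g(W,V)+2Y(\lambda)g(X,Z)g(W,V)\Big].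 \end{aligned}$$ Here $\mathfrak S_{ZWV}$ and $\mathfrak S_{ZW}$ denote cyclic sums, that is $\mathfrak S_{ZWV}F(Z,W,V)=F(Z,W,V)+F(W,V,Z)+F(V,Z,W)$ and $\mathfrak S_{ZW}F(Z,W)=F(Z,W)+F(W,Z)$, and $\tilde\nabla_XPJ$ is the covariant derivative of the endomorphism field $PJ$. -/

import Mathlib

open scoped Manifold ContDiff Quaternion

noncomputable section

/-- `ℍ × ℍ`, in which `𝕊³ × 𝕊³` (pairs of unit quaternions) sits. Its norm is only used as a
topology and for derivatives. -/
abbrev HH : Type := ℍ[ℝ] × ℍ[ℝ]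

/-- The model space of a 3-dimensional manifold. -/
abbrev E3 : Type := EuclideanSpace ℝ (Fin 3)

instance finrankQuaternionFact : Fact (Module.finrank ℝ ℍ[ℝ] = 3 + 1) :=
  ⟨Quaternion.finrank_eq_four⟩

/-- The 3-sphere of unit quaternions. -/
abbrev S3 : Type := Metric.sphere (0 : ℍ[ℝ]) 1

namespace NK

/-! ### The nearly Kähler structure on `𝕊³ × 𝕊³`

A point is `x = (p, q)`, a tangent vector at `x` is `w = (U, V) ∈ ℍ × ℍ` with `U ⟂ p`, `V ⟂ q`. -/

/-- `x` is a point of `𝕊³ × 𝕊³`. -/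
def OnS (x : HH) : Prop := ‖x.1‖ = 1 ∧ ‖x.2‖ = 1

/-- `w` is tangent to `𝕊³ × 𝕊³` at `x`. -/
def IsTangent (x w : HH) : Prop := inner ℝ x.1 w.1 = 0 ∧ inner ℝ x.2 w.2 = 0

/-- The almost complex structure `J (U, V) = 1/√3 (2 p q⁻¹ V - U, -2 q p⁻¹ U + V)`. -/
def J (x w : HH) : HH :=
  ((1 / √3 : ℝ) • ((2 : ℝ) • (x.1 * x.2⁻¹ * w.2) - w.1),
   (1 / √3 : ℝ) • (-((2 : ℝ) • (x.2 * x.1⁻¹ * w.1)) + w.2))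

/-- The product metric `⟨·,·⟩`. -/
def prodInner (w w' : HH) : ℝ := inner ℝ w.1 w'.1 + inner ℝ w.2 w'.2

/-- The nearly Kähler metric `g(Z, Z') = (⟨Z, Z'⟩ + ⟨J Z, J Z'⟩) / 2`. -/
def g (x w w' : HH) : ℝ := 1 / 2 * (prodInner w w' + prodInner (J x w) (J x w'))

/-- The almost product structure `P (U, V) = (p q⁻¹ V, q p⁻¹ U)`. -/
def P (x w : HH) : HH := (x.1 * x.2⁻¹ * w.2, x.2 * x.1⁻¹ * w.1)

/-- The composition `P J`. -/
def PJ (x w : HH) : HH := P x (J x w)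

/-- Orthogonal projection (for the product metric) onto the tangent space of `𝕊³ × 𝕊³` at `x`. -/
def tanProj (x w : HH) : HH :=
  (w.1 - (inner ℝ x.1 w.1 : ℝ) • x.1, w.2 - (inner ℝ x.2 w.2 : ℝ) • x.2)

/-- The difference tensor between the Levi-Civita connections of `g` and of the product metric:
with `X = (p a, q b)`, `Y = (p α, q β)` and `n = [a, β] - [b, α]` it is `(-p n / 6, q n / 6)`. -/
def diffTensor (x X Y : HH) : HH :=
  let a := x.1⁻¹ * X.1
  let b := x.2⁻¹ * X.2
  let α := x.1⁻¹ * Y.1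
  let β := x.2⁻¹ * Y.2
  let n := (a * β - β * a) - (b * α - α * b)
  (-((1 / 6 : ℝ) • (x.1 * n)), (1 / 6 : ℝ) • (x.2 * n))

/-- The Levi-Civita connection `∇̃` of `(𝕊³ × 𝕊³, g)`, acting on vector fields along maps.
For `u : E → ℍ × ℍ` with values in `𝕊³ × 𝕊³` and a field `ξ` of vectors tangent to `𝕊³ × 𝕊³` along
`u`, `nabla u ξ t X` is `∇̃_X ξ` at `t`. The theorems `isTangent_nabla`, `fderiv_g_eq` and
`nabla_torsionFree` below say that its values are tangent, that it is compatible with `g`, and that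
it is torsion free; for a parametrization `u` of `𝕊³ × 𝕊³` this characterizes `∇̃`. -/
def nabla {E : Type*} [NormedAddCommGroup E] [NormedSpace ℝ E]
    (u ξ : E → HH) (t X : E) : HH :=
  tanProj (u t) (fderiv ℝ ξ t X) + diffTensor (u t) (fderiv ℝ u t X) (ξ t)

/-! ### `nabla` is the Levi-Civita connection -/

theorem inv_eq_star {a : ℍ[ℝ]} (h : ‖a‖ = 1) : a⁻¹ = star a := by
  have h2 : Quaternion.normSq a = 1 := by
    rw [Quaternion.normSq_eq_norm_mul_self, h]; norm_num
  rw [Quaternion.inv_def, h2]; simp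

theorem star_mul_self_of {a : ℍ[ℝ]} (h : ‖a‖ = 1) : star a * a = 1 := by
  have h2 : Quaternion.normSq a = 1 := by
    rw [Quaternion.normSq_eq_norm_mul_self, h]; norm_num
  rw [Quaternion.star_mul_self, h2]; simp

theorem self_mul_star_of {a : ℍ[ℝ]} (h : ‖a‖ = 1) : a * star a = 1 := by
  have h2 : Quaternion.normSq a = 1 := by
    rw [Quaternion.normSq_eq_norm_mul_self, h]; norm_num
  rw [Quaternion.self_mul_star, h2]; simp

theorem inner_comp (a b : ℍ[ℝ]) :
    (inner ℝ a b : ℝ) = a.re * b.re + a.imI * b.imI + a.imJ * b.imJ + a.imK * b.imK := by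
  rw [Quaternion.inner_def]; simp [Quaternion.re_mul]

theorem inner_mul_left_of {p : ℍ[ℝ]} (h : ‖p‖ = 1) (x y : ℍ[ℝ]) :
    (inner ℝ (p * x) (p * y) : ℝ) = inner ℝ x y := by
  have h2 : p.re ^ 2 + p.imI ^ 2 + p.imJ ^ 2 + p.imK ^ 2 = 1 := by
    rw [← Quaternion.normSq_def', Quaternion.normSq_eq_norm_mul_self, h]; norm_num
  simp only [inner_comp, Quaternion.re_mul, Quaternion.imI_mul, Quaternion.imJ_mul,
    Quaternion.imK_mul]
  linear_combination (x.re * y.re + x.imI * y.imI + x.imJ * y.imJ + x.imK * y.imK) * h2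

theorem exists_eq_mul {p : ℍ[ℝ]} (h : ‖p‖ = 1) (w : ℍ[ℝ]) : ∃ a, w = p * a :=
  ⟨star p * w, by rw [← mul_assoc, self_mul_star_of h, one_mul]⟩

theorem star_mul_mul {p : ℍ[ℝ]} (h : ‖p‖ = 1) (a : ℍ[ℝ]) : star p * (p * a) = a := by
  rw [← mul_assoc, star_mul_self_of h, one_mul]

/-- The metric `g` on `𝕊³ × 𝕊³` in terms of the product metric. -/
theorem g_eq {x : HH} (hx : OnS x) (w w' : HH) :
    g x w w' = 4 / 3 * prodInner w w' -
      2 / 3 * (inner ℝ (star x.1 * w.1) (star x.2 * w'.2) +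
        inner ℝ (star x.1 * w'.1) (star x.2 * w.2)) := by
  obtain ⟨p, q⟩ := x
  obtain ⟨U, V⟩ := w
  obtain ⟨U', V'⟩ := w'
  obtain ⟨hp, hq⟩ := hx
  simp only at hp hq
  obtain ⟨a, rfl⟩ := exists_eq_mul hp U
  obtain ⟨b, rfl⟩ := exists_eq_mul hq V
  obtain ⟨a', rfl⟩ := exists_eq_mul hp U'
  obtain ⟨b', rfl⟩ := exists_eq_mul hq V'
  have hs : (1 / √3 : ℝ) * (1 / √3) = 1 / 3 := by
    rw [div_mul_div_comm, Real.mul_self_sqrt (by norm_num)]; norm_num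
  simp only [g, J, prodInner, inv_eq_star hp, inv_eq_star hq, mul_assoc, star_mul_mul hp,
    star_mul_mul hq, ← mul_smul_comm, ← mul_sub, ← mul_neg, ← mul_add, inner_mul_left_of hp,
    inner_mul_left_of hq]
  generalize (1 / √3 : ℝ) = s at hs
  simp only [inner_comp, Quaternion.re_smul, Quaternion.imI_smul, Quaternion.imJ_smul,
    Quaternion.imK_smul, Quaternion.re_sub, Quaternion.imI_sub, Quaternion.imJ_sub,
    Quaternion.imK_sub, Quaternion.re_add, Quaternion.imI_add, Quaternion.imJ_add,
    Quaternion.imK_add, Quaternion.re_neg, Quaternion.imI_neg, Quaternion.imJ_neg,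
    Quaternion.imK_neg, smul_eq_mul]
  linear_combination (1 / 2 *
    ((2 * b.re - a.re) * (2 * b'.re - a'.re) + (2 * b.imI - a.imI) * (2 * b'.imI - a'.imI) +
      (2 * b.imJ - a.imJ) * (2 * b'.imJ - a'.imJ) + (2 * b.imK - a.imK) * (2 * b'.imK - a'.imK) +
      (b.re - 2 * a.re) * (b'.re - 2 * a'.re) + (b.imI - 2 * a.imI) * (b'.imI - 2 * a'.imI) +
      (b.imJ - 2 * a.imJ) * (b'.imJ - 2 * a'.imJ) +
      (b.imK - 2 * a.imK) * (b'.imK - 2 * a'.imK))) * hs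

theorem fderiv_tangent {E : Type*} [NormedAddCommGroup E] [NormedSpace ℝ E]
    {u ξ : E → ℍ[ℝ]} {t : E} (hu : DifferentiableAt ℝ u t) (hξ : DifferentiableAt ℝ ξ t)
    {c : ℝ} (h : ∀ᶠ s in nhds t, (inner ℝ (u s) (ξ s) : ℝ) = c) (X : E) :
    (inner ℝ (u t) (fderiv ℝ ξ t X) : ℝ) + inner ℝ (fderiv ℝ u t X) (ξ t) = 0 := by
  rw [← fderiv_inner_apply ℝ hu hξ]
  have : (fun s => (inner ℝ (u s) (ξ s) : ℝ)) =ᶠ[nhds t] fun _ => c := h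
  rw [this.fderiv_eq]
  simp

theorem fderiv_onS {E : Type*} [NormedAddCommGroup E] [NormedSpace ℝ E]
    {u : E → HH} {t : E} (hu : DifferentiableAt ℝ u t) (hS : ∀ᶠ s in nhds t, OnS (u s)) (X : E) :
    IsTangent (u t) (fderiv ℝ u t X) := by
  have h1 := fderiv_tangent (u := fun s => (u s).1) (ξ := fun s => (u s).1) hu.fst hu.fst (c := 1)
    (hS.mono fun s hs => by simp [hs.1]) X
  have h2 := fderiv_tangent (u := fun s => (u s).2) (ξ := fun s => (u s).2) hu.snd hu.snd (c := 1)
    (hS.mono fun s hs => by simp [hs.2]) X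
  rw [real_inner_comm _ (fderiv ℝ _ t X)] at h1 h2
  rw [fderiv.fst hu] at h1
  rw [fderiv.snd hu] at h2
  simp only [ContinuousLinearMap.comp_apply, ContinuousLinearMap.coe_fst',
    ContinuousLinearMap.coe_snd'] at h1 h2
  exact ⟨by linarith, by linarith⟩

theorem re_of_tangent {p a : ℍ[ℝ]} (hp : ‖p‖ = 1) (h : (inner ℝ p (p * a) : ℝ) = 0) :
    a.re = 0 := by
  have := inner_mul_left_of hp 1 a
  rw [mul_one, h, inner_comp] at this
  simpa using this.symm

theorem tanProj_mul {p q : ℍ[ℝ]} (hp : ‖p‖ = 1) (hq : ‖q‖ = 1) (A B : ℍ[ℝ]) :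
    tanProj (p, q) (p * A, q * B) = (p * (A - (A.re : ℍ[ℝ])), q * (B - (B.re : ℍ[ℝ]))) := by
  have h1 := inner_mul_left_of hp 1 A
  have h2 := inner_mul_left_of hq 1 B
  rw [mul_one] at h1 h2
  simp only [tanProj, h1, h2, mul_sub]
  simp [inner_comp, Quaternion.mul_coe_eq_smul]

theorem diffTensor_mul {p q : ℍ[ℝ]} (hp : ‖p‖ = 1) (hq : ‖q‖ = 1) (a b α β : ℍ[ℝ]) :
    diffTensor (p, q) (p * a, q * b) (p * α, q * β) =
      (p * (-((1 / 6 : ℝ) • ((a * β - β * a) - (b * α - α * b)))),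
        q * ((1 / 6 : ℝ) • ((a * β - β * a) - (b * α - α * b)))) := by
  simp only [diffTensor, inv_eq_star hp, inv_eq_star hq, star_mul_mul hp, star_mul_mul hq,
    mul_smul_comm, mul_neg]

/-- The values of `nabla` are tangent to `𝕊³ × 𝕊³`. -/
theorem isTangent_nabla {E : Type*} [NormedAddCommGroup E] [NormedSpace ℝ E]
    (u ξ : E → HH) (t X : E) (hS : OnS (u t)) : IsTangent (u t) (nabla u ξ t X) := by
  unfold nabla
  generalize u t = x at *
  generalize fderiv ℝ u t X = U at *
  generalize ξ t = w at *
  generalize fderiv ℝ ξ t X = A at *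
  obtain ⟨p, q⟩ := x
  obtain ⟨U, V⟩ := U
  obtain ⟨w, z⟩ := w
  obtain ⟨A, B⟩ := A
  obtain ⟨hp, hq⟩ := hS
  simp only at hp hq
  obtain ⟨a, rfl⟩ := exists_eq_mul hp U
  obtain ⟨b, rfl⟩ := exists_eq_mul hq V
  obtain ⟨α, rfl⟩ := exists_eq_mul hp w
  obtain ⟨β, rfl⟩ := exists_eq_mul hq z
  obtain ⟨A, rfl⟩ := exists_eq_mul hp A
  obtain ⟨B, rfl⟩ := exists_eq_mul hq B
  rw [tanProj_mul hp hq, diffTensor_mul hp hq]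
  simp only [IsTangent, Prod.fst_add, Prod.snd_add, ← mul_add]
  constructor
  · have h1 := inner_mul_left_of hp 1
    rw [mul_one] at h1
    rw [h1, inner_comp]
    simp
    ring
  · have h1 := inner_mul_left_of hq 1
    rw [mul_one] at h1
    rw [h1, inner_comp]
    simp
    ring

/-- `nabla` is torsion free: for a map `u` into `𝕊³ × 𝕊³`, the fields `∂_X u` and `∂_Y u` satisfy
`∇̃_X ∂_Y u = ∇̃_Y ∂_X u`. -/
theorem nabla_torsionFree {E : Type*} [NormedAddCommGroup E] [NormedSpace ℝ E]
    {u : E → HH} {t : E} (hu : ContDiffAt ℝ 2 u t) (X Y : E) :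
    nabla u (fun s => fderiv ℝ u s Y) t X = nabla u (fun s => fderiv ℝ u s X) t Y := by
  have hd : DifferentiableAt ℝ (fderiv ℝ u) t :=
    (hu.fderiv_right (m := 1) (by norm_num)).differentiableAt (by norm_num)
  have hs : fderiv ℝ (fun s => fderiv ℝ u s Y) t X = fderiv ℝ (fun s => fderiv ℝ u s X) t Y := by
    rw [fderiv_clm_apply hd (differentiableAt_const _), fderiv_clm_apply hd
      (differentiableAt_const _)]
    simpa using (hu.isSymmSndFDerivAt (by simp)) X Y
  simp only [nabla, hs, diffTensor]
  congr 2 <;> abel_nf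

/-- `nabla` is compatible with the metric `g`. -/
theorem fderiv_g_eq {E : Type*} [NormedAddCommGroup E] [NormedSpace ℝ E]
    {u ξ η : E → HH} {t : E} (hu : DifferentiableAt ℝ u t) (hξ : DifferentiableAt ℝ ξ t)
    (hη : DifferentiableAt ℝ η t) (hS : ∀ᶠ s in nhds t, OnS (u s))
    (hξT : ∀ᶠ s in nhds t, IsTangent (u s) (ξ s)) (hηT : ∀ᶠ s in nhds t, IsTangent (u s) (η s))
    (X : E) :
    fderiv ℝ (fun s => g (u s) (ξ s) (η s)) t X =
      g (u t) (nabla u ξ t X) (η t) + g (u t) (ξ t) (nabla u η t X) := by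
  have hU := fderiv_onS hu hS X
  have e : (fun s => g (u s) (ξ s) (η s)) =ᶠ[nhds t] fun s =>
      4 / 3 * (inner ℝ (ξ s).1 (η s).1 + inner ℝ (ξ s).2 (η s).2) -
      2 / 3 * (inner ℝ (star (u s).1 * (ξ s).1) (star (u s).2 * (η s).2) +
        inner ℝ (star (u s).1 * (η s).1) (star (u s).2 * (ξ s).2)) :=
    hS.mono fun s hs => g_eq hs _ _
  rw [e.fderiv_eq]
  have d : ∀ {f : E → HH}, DifferentiableAt ℝ f t →
      HasFDerivAt (fun s => (f s).1) ((ContinuousLinearMap.fst ℝ _ _).comp (fderiv ℝ f t)) t ∧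
      HasFDerivAt (fun s => (f s).2) ((ContinuousLinearMap.snd ℝ _ _).comp (fderiv ℝ f t)) t :=
    fun hf => ⟨hf.hasFDerivAt.fst, hf.hasFDerivAt.snd⟩
  obtain ⟨u1, u2⟩ := d hu
  obtain ⟨x1, x2⟩ := d hξ
  obtain ⟨y1, y2⟩ := d hη
  let S : ℍ[ℝ] →L[ℝ] ℍ[ℝ] := LinearMap.toContinuousLinearMap
    { toFun := star, map_add' := star_add, map_smul' := fun r x => by ext <;> simp }
  have v1 : HasFDerivAt (fun s => star (u s).1) _ t := S.hasFDerivAt.comp t u1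
  have v2 : HasFDerivAt (fun s => star (u s).2) _ t := S.hasFDerivAt.comp t u2
  have D := (((x1.inner ℝ y1).add (x2.inner ℝ y2)).const_mul (4 / 3)).sub
    ((((v1.mul' x1).inner ℝ (v2.mul' y2)).add
      ((v1.mul' y1).inner ℝ (v2.mul' x2))).const_mul (2 / 3))
  rw [show fderiv ℝ (fun s => 4 / 3 * (inner ℝ (ξ s).1 (η s).1 + inner ℝ (ξ s).2 (η s).2) -
      2 / 3 * (inner ℝ (star (u s).1 * (ξ s).1) (star (u s).2 * (η s).2) +
        inner ℝ (star (u s).1 * (η s).1) (star (u s).2 * (ξ s).2))) t = _ from D.fderiv]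
  have hS' := hS.self_of_nhds
  have hξ' := hξT.self_of_nhds
  have hη' := hηT.self_of_nhds
  rw [g_eq hS', g_eq hS']
  have hSa : ∀ x, S x = star x := fun _ => rfl
  simp [hSa]
  simp only [nabla]
  clear D v1 v2 u1 u2 x1 x2 y1 y2 d e hS hξT hηT hSa
  generalize fderiv ℝ u t X = U at *
  generalize fderiv ℝ ξ t X = A at *
  generalize fderiv ℝ η t X = A' at *
  generalize ξ t = w at *
  generalize η t = w' at *
  generalize u t = x at *
  obtain ⟨p, q⟩ := x
  obtain ⟨U, V⟩ := U
  obtain ⟨w, z⟩ := w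
  obtain ⟨w', z'⟩ := w'
  obtain ⟨A, B⟩ := A
  obtain ⟨A', B'⟩ := A'
  obtain ⟨hp, hq⟩ := hS'
  simp only [IsTangent] at *
  obtain ⟨a, rfl⟩ := exists_eq_mul hp U
  obtain ⟨b, rfl⟩ := exists_eq_mul hq V
  obtain ⟨α, rfl⟩ := exists_eq_mul hp w
  obtain ⟨β, rfl⟩ := exists_eq_mul hq z
  obtain ⟨α', rfl⟩ := exists_eq_mul hp w'
  obtain ⟨β', rfl⟩ := exists_eq_mul hq z'
  obtain ⟨A, rfl⟩ := exists_eq_mul hp A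
  obtain ⟨B, rfl⟩ := exists_eq_mul hq B
  obtain ⟨A', rfl⟩ := exists_eq_mul hp A'
  obtain ⟨B', rfl⟩ := exists_eq_mul hq B'
  have r1 := re_of_tangent hp hU.1
  have r2 := re_of_tangent hq hU.2
  have r3 := re_of_tangent hp hξ'.1
  have r4 := re_of_tangent hq hξ'.2
  have r5 := re_of_tangent hp hη'.1
  have r6 := re_of_tangent hq hη'.2
  have s1 : ∀ x y : ℍ[ℝ], star (p * x) * (p * y) = star x * y := fun x y => by
    rw [star_mul, mul_assoc, star_mul_mul hp]
  have s2 : ∀ x y : ℍ[ℝ], star (q * x) * (q * y) = star x * y := fun x y => by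
    rw [star_mul, mul_assoc, star_mul_mul hq]
  rw [tanProj_mul hp hq, diffTensor_mul hp hq, tanProj_mul hp hq, diffTensor_mul hp hq]
  simp only [prodInner, Prod.fst_add, Prod.snd_add, ← mul_add, star_mul_mul hp, star_mul_mul hq,
    inner_mul_left_of hp, inner_mul_left_of hq, s1, s2]
  clear s1 s2 hU hξ' hη' hp hq
  simp [inner_comp, r1, r2, r3, r4, r5, r6]
  ring

/-! ### Covariant derivatives of tensor fields on `𝕊³ × 𝕊³` -/

/-- The left-invariant vector field on `𝕊³ × 𝕊³` with value `Y` at `x`. -/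
def leftExt (x Y y : HH) : HH := (y.1 * x.1⁻¹ * Y.1, y.2 * x.2⁻¹ * Y.2)

/-- The covariant derivative `(∇̃_X T) Y = ∇̃_X (T Y) - T (∇̃_X Y)` at `x ∈ 𝕊³ × 𝕊³` of a field `T`
of endomorphisms, for tangent vectors `X`, `Y` at `x` (`Y` is extended to a vector field; the result
does not depend on the extension). -/
def covDeriv (T : HH → HH → HH) (x X Y : HH) : HH :=
  nabla (fun y => y) (fun y => T y (leftExt x Y y)) x X -
    T x (nabla (fun y => y) (leftExt x Y) x X)

/-- The tensor `G = ∇̃ J`, that is `G(X, Y) = (∇̃_X J) Y`. -/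
def G (x X Y : HH) : HH := covDeriv J x X Y

/-! ### Immersed 3-dimensional submanifolds in local coordinates

Here `u : E3 → ℍ × ℍ` is (on an open set) a local parametrization of a submanifold of `𝕊³ × 𝕊³`,
`t` is a point of the coordinate domain, and tangent vectors of the submanifold at `t` are given by
their coordinate vectors in `E3`; `X` corresponds to the vector `fderiv ℝ u t X` in `ℍ × ℍ`. All
tensors are evaluated on vectors by extending these to fields with constant coordinates, whose
brackets vanish. -/

/-- The coordinate vectors. -/
def coordVec (i : Fin 3) : E3 := EuclideanSpace.single i 1

/-- The Gram matrix `g_ij = g(∂_i u, ∂_j u)` of the induced metric. -/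
def gram (u : E3 → HH) (t : E3) : Matrix (Fin 3) (Fin 3) ℝ :=
  Matrix.of fun i j => g (u t) (fderiv ℝ u t (coordVec i)) (fderiv ℝ u t (coordVec j))

/-- The coordinate vector of the `g`-orthogonal projection of `w` onto the tangent space of the
submanifold: its `i`-th coordinate is `∑ j, g^ij g(w, ∂_j u)`. -/
def tang (u : E3 → HH) (t : E3) (w : HH) : E3 :=
  WithLp.toLp 2 fun i => ∑ j, (gram u t)⁻¹ i j * g (u t) w (fderiv ℝ u t (coordVec j))

/-- The normal component of `w`. -/
def nor (u : E3 → HH) (t : E3) (w : HH) : HH := w - fderiv ℝ u t (tang u t w)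

/-- The induced connection: `∇_X Y` at `t`, the tangent part of `∇̃_X Y`, for a vector field `Y`. -/
def conn (u : E3 → HH) (Y : E3 → E3) (t X : E3) : E3 :=
  tang u t (nabla u (fun s => fderiv ℝ u s (Y s)) t X)

/-- The second fundamental form `h(X, Y)`, the normal part of `∇̃_X Y`. -/
def h (u : E3 → HH) (t X Y : E3) : HH :=
  nor u t (nabla u (fun s => fderiv ℝ u s Y) t X)

/-- The normal connection: `∇^⊥_X ξ` at `t`, the normal part of `∇̃_X ξ`, for a normal field `ξ`. -/
def normalConn (u : E3 → HH) (ξ : E3 → HH) (t X : E3) : HH := nor u t (nabla u ξ t X)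

/-- `(∇h)(X, Y, Z) = ∇^⊥_X h(Y, Z) - h(∇_X Y, Z) - h(Y, ∇_X Z)`. -/
def nablaH (u : E3 → HH) (t X Y Z : E3) : HH :=
  normalConn u (fun s => h u s Y Z) t X - h u t (conn u (fun _ => Y) t X) Z -
    h u t Y (conn u (fun _ => Z) t X)

/-- The curvature tensor `R(X, Y) Z = ∇_X ∇_Y Z - ∇_Y ∇_X Z - ∇_[X,Y] Z` of the induced connection
(`[X, Y] = 0` for the fields with constant coordinates). -/
def curv (u : E3 → HH) (t X Y Z : E3) : E3 :=
  conn u (fun s => conn u (fun _ => Z) s Y) t X - conn u (fun s => conn u (fun _ => Z) s X) t Y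

/-- The normal curvature `R^⊥(X, Y) ξ = ∇^⊥_X ∇^⊥_Y ξ - ∇^⊥_Y ∇^⊥_X ξ - ∇^⊥_[X,Y] ξ` at `t`, for a
normal field `ξ` (`[X, Y] = 0` for the fields with constant coordinates). -/
def normalCurv (u : E3 → HH) (ξ : E3 → HH) (t X Y : E3) : HH :=
  normalConn u (fun s => normalConn u ξ s Y) t X - normalConn u (fun s => normalConn u ξ s X) t Y

/-- The cyclic sum over two arguments. -/
def cyc2 (F : E3 → E3 → ℝ) (Z W : E3) : ℝ := F Z W + F W Z

/-- The cyclic sum over three arguments. -/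
def cyc3 (F : E3 → E3 → E3 → ℝ) (Z W V : E3) : ℝ := F Z W V + F W V Z + F V Z W

/-- The expression `I(X, Y, Z, W, V)`; `l` is the coordinate expression of the function `λ`. -/
def termI (u : E3 → HH) (l : E3 → ℝ) (t X Y Z W V : E3) : ℝ :=
  let x := u t
  let d := fun A : E3 => fderiv ℝ u t A
  let h' := h u t
  let DP := fun A B : E3 => covDeriv P x (d A) (d B)
  let DPJ := fun A B : E3 => covDeriv PJ x (d A) (d B)
  cyc3 (fun Z W V =>
    g x (P x (d Y)) (h' X Z) * g x (PJ x (d W)) (d V)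
    + g x (DP X Y + P x (h' X Y)) (d Z) * g x (PJ x (d W)) (d V)
    + g x (P x (d Y)) (d Z) * g x (PJ x (d W)) (h' X V)
    + g x (P x (d Y)) (d Z) * g x (DPJ X W + PJ x (h' X W)) (d V)
    - g x (P x (d X)) (h' Y Z) * g x (PJ x (d W)) (d V)
    - g x (DP Y X + P x (h' X Y)) (d Z) * g x (PJ x (d W)) (d V)
    - g x (P x (d X)) (d Z) * g x (PJ x (d W)) (h' Y V)
    - g x (P x (d X)) (d Z) * g x (DPJ Y W + PJ x (h' Y W)) (d V)
    - g x (PJ x (d Y)) (h' X Z) * g x (P x (d W)) (d V)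
    - g x (DPJ X Y + PJ x (h' X Y)) (d Z) * g x (P x (d W)) (d V)
    - g x (PJ x (d Y)) (d Z) * g x (P x (d W)) (h' X V)
    - g x (PJ x (d Y)) (d Z) * g x (DP X W + P x (h' X W)) (d V)
    + g x (PJ x (d X)) (h' Y Z) * g x (P x (d W)) (d V)
    + g x (DPJ Y X + PJ x (h' X Y)) (d Z) * g x (P x (d W)) (d V)
    + g x (PJ x (d X)) (d Z) * g x (P x (d W)) (h' Y V)
    + g x (PJ x (d X)) (d Z) * g x (DP Y W + P x (h' Y W)) (d V)
    - 2 * fderiv ℝ l t X * g x (d Y) (d Z) * g x (d W) (d V)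
    + 2 * fderiv ℝ l t Y * g x (d X) (d Z) * g x (d W) (d V)) Z W V

/-! ### Lagrangian and `J`-isotropic immersions -/

section Immersions

variable {M : Type*} [TopologicalSpace M] [ChartedSpace E3 M]

/-- A map to `𝕊³ × 𝕊³`, seen as a map to `ℍ × ℍ`. -/
def toHH (f : M → S3 × S3) (p : M) : HH := ((f p).1, (f p).2)

/-- `f` is a smooth immersion of the 3-manifold `M` in `𝕊³ × 𝕊³`. -/
def IsSmoothImmersion (f : M → S3 × S3) : Prop :=
  ContMDiff (𝓡 3) ((𝓡 3).prod (𝓡 3)) ∞ f ∧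
    ∀ p, Function.Injective (mfderiv (𝓡 3) ((𝓡 3).prod (𝓡 3)) f p)

/-- `f` is Lagrangian: `J TM = T^⊥M`, i.e. a vector tangent to `𝕊³ × 𝕊³` at `f p` is `J` applied to
a vector tangent to `M` if and only if it is `g`-orthogonal to all vectors tangent to `M`. -/
def IsLagrangian (f : M → S3 × S3) : Prop :=
  ∀ (p : M) (w : HH), IsTangent (toHH f p) w →
    ((∃ X : TangentSpace (𝓡 3) p, J (toHH f p) (mfderiv (𝓡 3) 𝓘(ℝ, HH) (toHH f) p X) = w) ↔
      ∀ Y : TangentSpace (𝓡 3) p,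
        g (toHH f p) w (mfderiv (𝓡 3) 𝓘(ℝ, HH) (toHH f) p Y) = 0)

/-- The local parametrization of the immersion `f` given by a chart `φ` of `M`. -/
def param (f : M → S3 × S3) (φ : OpenPartialHomeomorph M E3) : E3 → HH := toHH f ∘ φ.symm

/-- `f` is `J`-isotropic with function `lam`: `g((∇h)(v, v, v), J v) = λ g(v, v)²` for all tangent
vectors `v`. Both sides are tensorial; they are written in the charts of the atlas of `M`. -/
def IsJIsotropic (f : M → S3 × S3) (lam : M → ℝ) : Prop :=
  ∀ φ ∈ atlas E3 M, ∀ t ∈ φ.target, ∀ v : E3,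
    g (param f φ t) (nablaH (param f φ) t v v v) (J (param f φ t) (fderiv ℝ (param f φ) t v)) =
      lam (φ.symm t) *
        g (param f φ t) (fderiv ℝ (param f φ) t v) (fderiv ℝ (param f φ) t v) ^ 2

end Immersions

end NK

end

/-! The argument revolves around the cubic form C(X, Y, Z) = g(h(X, Y), JZ): J-isotropy and the
Codazzi equation together determine its covariant derivative ∇C, and the identity is the
integrability condition obtained by differentiating once more.

Ambient geometry. Writing tangent vectors at x as x * a with a a pair of imaginary quaternions turns
g, J, P and G into constant tensors, and turns the Levi-Civita connection into d + ω with ω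
constant. The formula for the derivative of G and the curvature formula are then algebraic
identities (`invG_covDeriv`, `omega_curvature`). They pass to vector fields along maps through
`IsMapOn.nabla_eq`, which yields `IsMapOn.nabla_G` and `IsMapOn.nabla_nabla_sub`.

Lagrangian geometry. Differentiating g(Y, JZ) = 0 shows that G of two tangent vectors is normal and
that C is totally symmetric (`isNormal_G`, `cubic_swap_right`). Differentiating g(Z, G(X, Y)) = 0
gives the cyclic identity `g_h_G_cyclic`. Consequently ∇C is symmetric in its last three arguments.
It differs from g(∇h, J ·) by a term g(h, G), because J is not parallel (`covCubic_eq`).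

Determination of ∇C. Codazzi prescribes the difference of ∇C under exchange of its first two
arguments (`covCubic_sub_swap`). Isotropy, polarized, prescribes the sum over the choice of first
argument (`covCubic_symm`). For a tensor symmetric in its last three arguments these data suffice,
and `covCubic_explicit` expresses ∇C through λ, the restrictions of g(P ·, ·) and g(PJ ·, ·), and
the tensor g(h, G).

Second derivative. The expression for ∇C is differentiated and skew-symmetrized in X and Y. By the
Ricci identity (`fderiv_covCubic_sub`) one side is the action of R on C. The Ricci equation
(`g_normalCurv_h`) replaces its part -C(Z, W, R(X, Y)V) by g(R^⊥(X, Y)h(Z, W), JV), up to products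
of g with C. On the other side the derivatives of λ, P and PJ assemble to the expression I. Of the
three g(h, G) terms, one leaves the difference of terms g(∇h, G), and the other two are reduced by
Codazzi to products of values of P and JP. The derivative of G accounts for the remaining products
of g with C.

Smoothness of λ needs no extra assumption: λ is a quotient of ∇C(v, v, v, v) by a positive smooth
function, for a fixed nonzero coordinate vector v. -/

noncomputable section

namespace NK

/-! ### The left-invariant tensors on pairs of imaginary quaternions -/

/-- A pair of imaginary quaternions. -/
def IsIm (a : HH) : Prop := a.1.re = 0 ∧ a.2.re = 0

/-- The left-invariant form of `√3 J`. -/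
def invJ₁ : HH →ₗ[ℝ] HH where
  toFun a := ((2 : ℝ) • a.2 - a.1, a.2 - (2 : ℝ) • a.1)
  map_add' a b := by ext <;> simp <;> ring
  map_smul' r a := by ext <;> simp <;> ring

/-- The left-invariant form of `J`. -/
def invJ : HH →ₗ[ℝ] HH := (1 / √3 : ℝ) • invJ₁

/-- The left-invariant form of `P`. -/
def invP : HH →ₗ[ℝ] HH where
  toFun a := (a.2, a.1)
  map_add' _ _ := rfl
  map_smul' _ _ := rfl

/-- The connection form of `∇̃` in the left-invariant frame. -/
def omega : HH →ₗ[ℝ] HH →ₗ[ℝ] HH :=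
  LinearMap.mk₂ ℝ (fun a b =>
    ((1 / 2 : ℝ) • (a.1 * b.1 - b.1 * a.1) -
      (1 / 6 : ℝ) • ((a.1 * b.2 - b.2 * a.1) - (a.2 * b.1 - b.1 * a.2)),
     (1 / 2 : ℝ) • (a.2 * b.2 - b.2 * a.2) +
      (1 / 6 : ℝ) • ((a.1 * b.2 - b.2 * a.1) - (a.2 * b.1 - b.1 * a.2))))
    (fun a a' b => by
      refine Prod.ext ?_ ?_ <;> simp only [Prod.fst_add, Prod.snd_add, mul_add, add_mul] <;> module)
    (fun r a b => by
      refine Prod.ext ?_ ?_ <;>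
        simp only [Prod.smul_fst, Prod.smul_snd, mul_smul_comm, smul_mul_assoc] <;> module)
    (fun a b b' => by
      refine Prod.ext ?_ ?_ <;> simp only [Prod.fst_add, Prod.snd_add, mul_add, add_mul] <;> module)
    (fun r a b => by
      refine Prod.ext ?_ ?_ <;>
        simp only [Prod.smul_fst, Prod.smul_snd, mul_smul_comm, smul_mul_assoc] <;> module)

/-- The left-invariant form of the metric `g`. -/
def invg (a b : HH) : ℝ :=
  4 / 3 * (inner ℝ a.1 b.1 + inner ℝ a.2 b.2) - 2 / 3 * (inner ℝ a.1 b.2 + inner ℝ b.1 a.2)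

/-- The left-invariant form of `√3 G`. -/
def invG₁ : HH →ₗ[ℝ] HH →ₗ[ℝ] HH := omega.compl₂ invJ₁ - omega.compr₂ invJ₁

/-- The left-invariant form of `G`. -/
def invG : HH →ₗ[ℝ] HH →ₗ[ℝ] HH := (1 / √3 : ℝ) • invG₁

theorem invJ₁_apply (a : HH) : invJ₁ a = ((2 : ℝ) • a.2 - a.1, a.2 - (2 : ℝ) • a.1) := rfl
theorem invP_apply (a : HH) : invP a = (a.2, a.1) := rfl
theorem invJ_apply (a : HH) : invJ a = (1 / √3 : ℝ) • invJ₁ a := rfl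
theorem invG_apply (a b : HH) : invG a b = (1 / √3 : ℝ) • invG₁ a b := rfl
theorem invG₁_apply (a b : HH) : invG₁ a b = omega a (invJ₁ b) - invJ₁ (omega a b) := rfl
theorem omega_apply (a b : HH) : omega a b =
    ((1 / 2 : ℝ) • (a.1 * b.1 - b.1 * a.1) -
      (1 / 6 : ℝ) • ((a.1 * b.2 - b.2 * a.1) - (a.2 * b.1 - b.1 * a.2)),
     (1 / 2 : ℝ) • (a.2 * b.2 - b.2 * a.2) +
      (1 / 6 : ℝ) • ((a.1 * b.2 - b.2 * a.1) - (a.2 * b.1 - b.1 * a.2))) := rfl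

theorem invG_eq (a b : HH) : invG a b = omega a (invJ b) - invJ (omega a b) := by
  rw [invG_apply, invG₁_apply, invJ_apply, invJ_apply, map_smul, smul_sub]

theorem one_div_sqrt_three_mul_self : (1 / √3 : ℝ) * (1 / √3) = 1 / 3 := by
  rw [div_mul_div_comm, Real.mul_self_sqrt (by norm_num)]; norm_num

theorem isIm_invJ {a : HH} (ha : IsIm a) : IsIm (invJ a) := by
  simp [IsIm, invJ_apply, invJ₁_apply, ha.1, ha.2]

theorem isIm_invP {a : HH} (ha : IsIm a) : IsIm (invP a) := ⟨ha.2, ha.1⟩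

theorem isIm_omega (a b : HH) : IsIm (omega a b) := by
  simp only [IsIm, omega_apply]
  constructor <;> simp <;> ring

theorem isIm_invG (a : HH) {b : HH} : IsIm (invG a b) := by
  rw [invG_eq]
  have h1 := isIm_omega a (invJ b)
  have h2 := isIm_invJ (isIm_omega a b)
  simp [IsIm, h1.1, h1.2, h2.1, h2.2]

/-! ### Algebraic relations between g, J, P and G -/

theorem invg_smul_left (r : ℝ) (a b : HH) : invg (r • a) b = r * invg a b := by
  simp only [invg, inner_comp]; simp; ring

theorem invg_comm (a b : HH) : invg a b = invg b a := by
  simp only [invg, inner_comp]; ring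

theorem invJ₁_invJ₁ (a : HH) : invJ₁ (invJ₁ a) = (-3 : ℝ) • a := by
  simp only [invJ₁_apply]; ext <;> simp <;> ring

theorem invJ_invJ (a : HH) : invJ (invJ a) = -a := by
  rw [invJ_apply, invJ_apply, map_smul, smul_smul, one_div_sqrt_three_mul_self, invJ₁_invJ₁,
    smul_smul]
  norm_num

theorem invg_invJ_left (a b : HH) : invg (invJ a) b = -invg a (invJ b) := by
  rw [invJ_apply, invJ_apply, invg_comm a, invg_smul_left, invg_smul_left]
  generalize (1 / √3 : ℝ) = s
  simp only [invg, inner_comp, invJ₁_apply]; simp; ring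

theorem invg_invP_left (a b : HH) : invg (invP a) b = invg a (invP b) := by
  simp only [invg, inner_comp, invP_apply]; ring

theorem invP_invJ (a : HH) : invP (invJ a) = -invJ (invP a) := by
  rw [invJ_apply, invJ_apply, map_smul, ← smul_neg]
  congr 1
  simp only [invP_apply, invJ₁_apply]; ext <;> simp

theorem invg_pos_of_ne {a : HH} (ha : a ≠ 0) : 0 < invg a a := by
  have h1 : invg a a = 2 / 3 * (inner ℝ a.1 a.1 + inner ℝ a.2 a.2) +
      2 / 3 * (inner ℝ (a.1 - a.2) (a.1 - a.2)) := by
    simp only [invg, inner_comp]; simp; ring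
  have h2 : 0 < (inner ℝ a.1 a.1 : ℝ) + inner ℝ a.2 a.2 := by
    by_contra hc
    have h3 : 0 ≤ (inner ℝ a.1 a.1 : ℝ) := real_inner_self_nonneg
    have h4 : 0 ≤ (inner ℝ a.2 a.2 : ℝ) := real_inner_self_nonneg
    exact ha (Prod.ext (inner_self_eq_zero.1 (by linarith : (inner ℝ a.1 a.1 : ℝ) = 0))
      (inner_self_eq_zero.1 (by linarith : (inner ℝ a.2 a.2 : ℝ) = 0)))
  have h5 : 0 ≤ (inner ℝ (a.1 - a.2) (a.1 - a.2) : ℝ) := real_inner_self_nonneg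
  rw [h1]; linarith

/-- The mixed commutators occur only in the combination [a₁, b₂] + [a₂, b₁], which makes the
skew-symmetry of G visible. -/
theorem invG₁_apply_im {a b : HH} (ha : IsIm a) (hb : IsIm b) : invG₁ a b =
    ((1 / 3 : ℝ) • (a.1 * b.1 - b.1 * a.1 + (a.1 * b.2 - b.2 * a.1)
      + (a.2 * b.1 - b.1 * a.2) - (2 : ℝ) • (a.2 * b.2 - b.2 * a.2)),
     (1 / 3 : ℝ) • ((2 : ℝ) • (a.1 * b.1 - b.1 * a.1) - (a.1 * b.2 - b.2 * a.1)
      - (a.2 * b.1 - b.1 * a.2) - (a.2 * b.2 - b.2 * a.2))) := by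
  obtain ⟨a, a'⟩ := a
  obtain ⟨ha₁, ha₂⟩ := ha
  simp only at ha₁ ha₂
  obtain ⟨b, b'⟩ := b
  obtain ⟨hb₁, hb₂⟩ := hb
  simp only at hb₁ hb₂
  simp only [invG₁_apply, omega_apply, invJ₁_apply]
  ext <;> simp [ha₁, ha₂, hb₁, hb₂] <;> ring

theorem invG_antisymm {a b : HH} (ha : IsIm a) (hb : IsIm b) : invG a b = -invG b a := by
  rw [invG_apply, invG_apply, invG₁_apply_im ha hb, invG₁_apply_im hb ha, ← smul_neg]
  congr 1
  ext <;> simp <;> ring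

theorem invg_invG_left {a b c : HH} (ha : IsIm a) (hb : IsIm b) (hc : IsIm c) :
    invg (invG a b) c = -invg b (invG a c) := by
  rw [invG_apply, invG_apply, invg_comm b, invg_smul_left, invg_smul_left, ← mul_neg,
    invG₁_apply_im ha hb, invG₁_apply_im ha hc]
  congr 1
  obtain ⟨a, a'⟩ := a
  obtain ⟨ha₁, ha₂⟩ := ha
  simp only at ha₁ ha₂
  obtain ⟨b, b'⟩ := b
  obtain ⟨hb₁, hb₂⟩ := hb
  simp only at hb₁ hb₂
  obtain ⟨c, c'⟩ := c
  obtain ⟨hc₁, hc₂⟩ := hc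
  simp only at hc₁ hc₂
  simp only [invg, inner_comp]; simp [ha₁, ha₂, hb₁, hb₂, hc₁, hc₂]; ring

/-- This is the derivative of J² = -1. -/
theorem invG_invJ {a b : HH} (ha : IsIm a) (hb : IsIm b) :
    invG a (invJ b) = -invJ (invG a b) := by
  simp only [invJ_apply, invG_apply, map_smul]
  rw [smul_smul, smul_smul, ← smul_neg]
  congr 1
  obtain ⟨a, a'⟩ := a
  obtain ⟨ha₁, ha₂⟩ := ha
  simp only at ha₁ ha₂
  obtain ⟨b, b'⟩ := b
  obtain ⟨hb₁, hb₂⟩ := hb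
  simp only at hb₁ hb₂
  simp only [invG₁_apply, omega_apply, invJ₁_apply]
  ext <;> simp [ha₁, ha₂, hb₁, hb₂] <;> ring

/-! ### The derivative of G and the curvature, by commutator algebra -/

/-- The commutator of quaternions as a bilinear map. -/
def commLin : ℍ[ℝ] →ₗ[ℝ] ℍ[ℝ] →ₗ[ℝ] ℍ[ℝ] := LinearMap.mul ℝ ℍ[ℝ] - (LinearMap.mul ℝ ℍ[ℝ]).flip

theorem commLin_apply (x y : ℍ[ℝ]) : commLin x y = x * y - y * x := rfl

/-- In terms of a bilinear commutator, iterated applications of ω and G expand by linearity, and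
nested commutators collapse by the double vector product formula. The identities below then become
linear relations with inner products as coefficients, with no expansion into quaternion components.
-/
theorem omega_eq_commLin (a b : HH) : omega a b =
    ((1 / 2 : ℝ) • commLin a.1 b.1 - (1 / 6 : ℝ) • (commLin a.1 b.2 - commLin a.2 b.1),
     (1 / 2 : ℝ) • commLin a.2 b.2 + (1 / 6 : ℝ) • (commLin a.1 b.2 - commLin a.2 b.1)) := rfl

theorem invG₁_eq_commLin {a b : HH} (ha : IsIm a) (hb : IsIm b) : invG₁ a b =
    ((1 / 3 : ℝ) • (commLin a.1 b.1 + commLin a.1 b.2 + commLin a.2 b.1 - (2 : ℝ) • commLin a.2 b.2),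
     (1 / 3 : ℝ) • ((2 : ℝ) • commLin a.1 b.1 - commLin a.1 b.2 - commLin a.2 b.1 - commLin a.2 b.2)) :=
  invG₁_apply_im ha hb

/-- The double vector product formula. -/
theorem commLin_commLin_of_im {x y z : ℍ[ℝ]} (hx : x.re = 0) (hy : y.re = 0) (hz : z.re = 0) :
    commLin x (commLin y z) = (4 * inner ℝ x z : ℝ) • y - (4 * inner ℝ x y : ℝ) • z := by
  simp only [commLin_apply, inner_comp]
  ext <;> simp [hx, hy, hz] <;> ring

theorem commLin_commLin_of_im' {x y z : ℍ[ℝ]} (hx : x.re = 0) (hy : y.re = 0) (hz : z.re = 0) :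
    commLin (commLin x y) z = (4 * inner ℝ x z : ℝ) • y - (4 * inner ℝ y z : ℝ) • x := by
  have h := commLin_commLin_of_im hz hx hy
  rw [real_inner_comm x z, real_inner_comm y z] at h
  rw [← neg_sub, ← h, commLin_apply z, commLin_apply _ z, neg_sub]

/-- The covariant derivative of the left-invariant form of `G`. -/
theorem invG_covDeriv {a b c : HH} (ha : IsIm a) (hb : IsIm b) (hc : IsIm c) :
    omega a (invG b c) - invG (omega a b) c - invG b (omega a c) =
      (1 / 3 : ℝ) • (invg a c • invJ b - invg a b • invJ c - invg (invJ b) c • a) := by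
  -- Both sides are linear in the factor 1/√3 carried by G and J, so the identity is proved for the
  -- rescaled tensors, where no square root occurs.
  have key : omega a (invG₁ b c) - invG₁ (omega a b) c - invG₁ b (omega a c) =
      (1 / 3 : ℝ) • (invg a c • invJ₁ b - invg a b • invJ₁ c - invg (invJ₁ b) c • a) := by
    rw [invG₁_eq_commLin hb hc, invG₁_eq_commLin (isIm_omega a b) hc, invG₁_eq_commLin hb (isIm_omega a c)]
    obtain ⟨a, a'⟩ := a
    obtain ⟨b, b'⟩ := b
    obtain ⟨c, c'⟩ := c
    simp only [IsIm] at ha hb hc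
    simp only [omega_eq_commLin, invg, invJ₁_apply, map_add, map_sub, map_smul,
      LinearMap.add_apply, LinearMap.sub_apply, LinearMap.smul_apply, commLin_commLin_of_im, commLin_commLin_of_im', ha.1, ha.2, hb.1, hb.2, hc.1, hc.2, inner_sub_left,
      inner_sub_right, real_inner_smul_left, real_inner_smul_right, Prod.mk_sub_mk, Prod.smul_mk]
    simp only [real_inner_comm a b, real_inner_comm a b', real_inner_comm a' b,
      real_inner_comm a' b', real_inner_comm a' c, real_inner_comm b c, real_inner_comm b' c]
    congr 1 <;> module
  simp only [invJ_apply, invG_apply, map_smul, invg_smul_left]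
  rw [← smul_sub, ← smul_sub, key]
  module

/-- The left-invariant form of the curvature tensor of `∇̃`. -/
theorem omega_curvature {a b c : HH} (ha : IsIm a) (hb : IsIm b) (hc : IsIm c) :
    omega a (omega b c) - omega b (omega a c) - omega (a * b - b * a) c =
      (5 / 12 : ℝ) • (invg b c • a - invg a c • b)
      + (1 / 12 : ℝ) • (invg (invJ b) c • invJ a - invg (invJ a) c • invJ b
          - (2 * invg (invJ a) b) • invJ c)
      + (1 / 3 : ℝ) • (invg (invP b) c • invP a - invg (invP a) c • invP b
          + invg (invJ (invP b)) c • invJ (invP a) - invg (invJ (invP a)) c • invJ (invP b)) := by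
  -- J enters the curvature only in pairs, so the square roots combine to 1/3.
  have hs : ∀ (r : ℝ) (a : HH), (1 / √3 * r) • (1 / √3 : ℝ) • a = (1 / 3 * r) • a := fun r a => by
    rw [smul_smul, ← one_div_sqrt_three_mul_self]; ring_nf
  have hs2 : ∀ (r : ℝ) (a : HH), (2 * (1 / √3 * r)) • (1 / √3 : ℝ) • a = (2 / 3 * r) • a :=
    fun r a => by
      rw [← mul_assoc, mul_comm (2 : ℝ), mul_assoc, hs]; ring_nf
  simp only [invJ_apply, invg_smul_left, hs, hs2]
  have hab : a * b - b * a = (commLin a.1 b.1, commLin a.2 b.2) := rfl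
  rw [hab]
  obtain ⟨a, a'⟩ := a
  obtain ⟨b, b'⟩ := b
  obtain ⟨c, c'⟩ := c
  simp only [IsIm] at ha hb hc
  simp only [omega_eq_commLin, invg, invJ₁_apply, invP_apply, map_add, map_sub, map_smul,
    commLin_commLin_of_im, commLin_commLin_of_im', ha.1, ha.2, hb.1, hb.2, hc.1, hc.2, inner_sub_left,
    inner_sub_right, real_inner_smul_left, real_inner_smul_right, Prod.mk_sub_mk, Prod.smul_mk, Prod.mk_add_mk]
  simp only [real_inner_comm a b, real_inner_comm a b', real_inner_comm a' b,
    real_inner_comm a' b', real_inner_comm a c, real_inner_comm a' c, real_inner_comm b c,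
    real_inner_comm b' c]
  congr 1 <;> module

/-! ### Tangent vectors of `𝕊³ × 𝕊³` in the left-invariant frame -/

theorem star_mul_mul_of_onS {x : HH} (hx : OnS x) (a : HH) : star x * (x * a) = a :=
  Prod.ext (star_mul_mul hx.1 _) (star_mul_mul hx.2 _)

theorem mul_star_mul_of_onS {x : HH} (hx : OnS x) (w : HH) : x * (star x * w) = w := by
  refine Prod.ext ?_ ?_
  · simp [← mul_assoc, self_mul_star_of hx.1]
  · simp [← mul_assoc, self_mul_star_of hx.2]

theorem isTangent_mul_iff {x : HH} (hx : OnS x) (a : HH) : IsTangent x (x * a) ↔ IsIm a := by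
  have h1 := inner_mul_left_of hx.1 1 a.1
  have h2 := inner_mul_left_of hx.2 1 a.2
  rw [mul_one] at h1 h2
  simp [IsTangent, IsIm, h1, h2, inner_comp]

theorem isIm_star_mul {x w : HH} (hx : OnS x) (hw : IsTangent x w) : IsIm (star x * w) := by
  rwa [← isTangent_mul_iff hx, mul_star_mul_of_onS hx]

theorem IsTangent.exists_eq_mul {x w : HH} (hx : OnS x) (hw : IsTangent x w) :
    ∃ a, IsIm a ∧ w = x * a :=
  ⟨star x * w, isIm_star_mul hx hw, (mul_star_mul_of_onS hx w).symm⟩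

theorem OnS.ne_zero {x : HH} (hx : OnS x) : x.1 ≠ 0 ∧ x.2 ≠ 0 :=
  ⟨fun h => by simpa [h] using hx.1, fun h => by simpa [h] using hx.2⟩

theorem J_mul {x : HH} (hx : x.1 ≠ 0 ∧ x.2 ≠ 0) (a : HH) : J x (x * a) = x * invJ a := by
  refine Prod.ext ?_ ?_ <;>
  simp [J, invJ_apply, invJ₁_apply, mul_assoc, hx.1, hx.2, mul_sub]; module

theorem P_mul {x : HH} (hx : x.1 ≠ 0 ∧ x.2 ≠ 0) (a : HH) : P x (x * a) = x * invP a := by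
  refine Prod.ext ?_ ?_ <;> simp [P, invP_apply, mul_assoc, hx.1, hx.2]

theorem PJ_mul {x : HH} (hx : x.1 ≠ 0 ∧ x.2 ≠ 0) (a : HH) :
    PJ x (x * a) = x * (invP ∘ₗ invJ) a := by
  rw [PJ, J_mul hx, P_mul hx]; rfl

theorem g_mul {x : HH} (hx : OnS x) (a b : HH) : g x (x * a) (x * b) = invg a b := by
  simp only [g_eq hx, prodInner, invg, Prod.fst_mul, Prod.snd_mul, star_mul_mul hx.1,
    star_mul_mul hx.2, inner_mul_left_of hx.1, inner_mul_left_of hx.2]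

theorem J_add (x w w' : HH) : J x (w + w') = J x w + J x w' := by
  refine Prod.ext ?_ ?_ <;> simp only [J, Prod.fst_add, Prod.snd_add, mul_add] <;> module

theorem J_smul (x : HH) (r : ℝ) (w : HH) : J x (r • w) = r • J x w := by
  refine Prod.ext ?_ ?_ <;> simp only [J, Prod.smul_fst, Prod.smul_snd, mul_smul_comm] <;> module

theorem P_add (x w w' : HH) : P x (w + w') = P x w + P x w' := by
  refine Prod.ext ?_ ?_ <;> simp [P, mul_add]

theorem PJ_add (x w w' : HH) : PJ x (w + w') = PJ x w + PJ x w' := by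
  rw [PJ, J_add, P_add]; rfl

theorem g_comm (x w w' : HH) : g x w w' = g x w' w := by
  simp only [g, prodInner]
  rw [real_inner_comm, real_inner_comm w.2, real_inner_comm (J x w).1, real_inner_comm (J x w).2]

theorem g_add_left (x w w' v : HH) : g x (w + w') v = g x w v + g x w' v := by
  simp only [g, prodInner, J_add, Prod.fst_add, Prod.snd_add, inner_add_left]; ring

theorem g_smul_left (x : HH) (r : ℝ) (w v : HH) : g x (r • w) v = r * g x w v := by
  simp only [g, prodInner, J_smul, Prod.smul_fst, Prod.smul_snd, real_inner_smul_left]; ring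

theorem g_add_right (x w w' v : HH) : g x v (w + w') = g x v w + g x v w' := by
  rw [g_comm, g_add_left, g_comm x w, g_comm x w']

theorem g_smul_right (x : HH) (r : ℝ) (w v : HH) : g x v (r • w) = r * g x v w := by
  rw [g_comm, g_smul_left, g_comm]

theorem g_neg_left (x w v : HH) : g x (-w) v = -g x w v := by
  rw [← neg_one_smul ℝ w, g_smul_left]; ring

theorem g_neg_right (x w v : HH) : g x v (-w) = -g x v w := by
  rw [g_comm, g_neg_left, g_comm]

theorem g_sub_left (x w w' v : HH) : g x (w - w') v = g x w v - g x w' v := by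
  rw [sub_eq_add_neg, g_add_left, g_neg_left]; ring

theorem g_sub_right (x w w' v : HH) : g x v (w - w') = g x v w - g x v w' := by
  rw [g_comm, g_sub_left, g_comm x w, g_comm x w']

theorem g_sum_left {ι : Type*} (s : Finset ι) (x : HH) (w : ι → HH) (v : HH) :
    g x (∑ i ∈ s, w i) v = ∑ i ∈ s, g x (w i) v :=
  map_sum ({ toFun := fun w => g x w v
             map_zero' := by simpa using g_smul_left x 0 0 v
             map_add' := fun _ _ => g_add_left x _ _ v } : HH →+ ℝ) w s

theorem g_self_pos {x w : HH} (hx : OnS x) (hw : w ≠ 0) : 0 < g x w w := by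
  rw [← mul_star_mul_of_onS hx w, g_mul hx]
  refine invg_pos_of_ne fun h => hw ?_
  rw [← mul_star_mul_of_onS hx w, h, mul_zero]

theorem J_J {x : HH} (hx : OnS x) (w : HH) : J x (J x w) = -w := by
  rw [← mul_star_mul_of_onS hx w, J_mul hx.ne_zero, J_mul hx.ne_zero, invJ_invJ, mul_neg]

theorem g_J_left {x : HH} (hx : OnS x) (w v : HH) : g x (J x w) v = -g x w (J x v) := by
  rw [← mul_star_mul_of_onS hx w, ← mul_star_mul_of_onS hx v, J_mul hx.ne_zero, J_mul hx.ne_zero,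
    g_mul hx, g_mul hx, invg_invJ_left]

theorem g_J_J {x : HH} (hx : OnS x) (w v : HH) : g x (J x w) (J x v) = g x w v := by
  rw [g_J_left hx, J_J hx, g_neg_right, neg_neg]

theorem g_P_left {x : HH} (hx : OnS x) (w v : HH) : g x (P x w) v = g x w (P x v) := by
  rw [← mul_star_mul_of_onS hx w, ← mul_star_mul_of_onS hx v, P_mul hx.ne_zero, P_mul hx.ne_zero,
    g_mul hx, g_mul hx, invg_invP_left]

theorem PJ_eq {x : HH} (hx : OnS x) (w : HH) : PJ x w = -J x (P x w) := by
  rw [PJ, ← mul_star_mul_of_onS hx w, J_mul hx.ne_zero, P_mul hx.ne_zero, P_mul hx.ne_zero,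
    J_mul hx.ne_zero, invP_invJ, mul_neg]

theorem isTangent_J {x w : HH} (hx : OnS x) (hw : IsTangent x w) : IsTangent x (J x w) := by
  obtain ⟨a, ha, rfl⟩ := hw.exists_eq_mul hx
  rw [J_mul hx.ne_zero, isTangent_mul_iff hx]
  exact isIm_invJ ha

theorem IsTangent.add {x w w' : HH} (hw : IsTangent x w) (hw' : IsTangent x w') :
    IsTangent x (w + w') := by
  simp [IsTangent, inner_add_right, hw.1, hw.2, hw'.1, hw'.2]

theorem IsTangent.neg {x w : HH} (hw : IsTangent x w) : IsTangent x (-w) := by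
  simp [IsTangent, hw.1, hw.2]

theorem IsTangent.sub {x w w' : HH} (hw : IsTangent x w) (hw' : IsTangent x w') :
    IsTangent x (w - w') := sub_eq_add_neg w w' ▸ hw.add hw'.neg

/-! ### The connection in the left-invariant frame -/

/-- Projecting a * b + c removes its real part and leaves c + [a, b]/2, the connection of the
product metric in the left-invariant frame; `diffTensor` supplies the rest of ω. -/
theorem nabla_of_eq {E : Type*} [NormedAddCommGroup E] [NormedSpace ℝ E] {u ξ : E → HH} {t X : E}
    {a b c : HH} (hu : OnS (u t)) (ha : IsIm a) (hb : IsIm b) (hc : IsIm c)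
    (hua : fderiv ℝ u t X = u t * a) (hξ : ξ t = u t * b)
    (hξ' : fderiv ℝ ξ t X = u t * (a * b + c)) :
    nabla u ξ t X = u t * (c + omega a b) := by
  rw [nabla, hua, hξ, hξ']
  generalize u t = x at *
  obtain ⟨p, q⟩ := x
  obtain ⟨hp, hq⟩ := hu
  simp only at hp hq
  obtain ⟨a, a'⟩ := a
  obtain ⟨b, b'⟩ := b
  obtain ⟨c, c'⟩ := c
  obtain ⟨ha, ha'⟩ := ha
  obtain ⟨hb, hb'⟩ := hb
  obtain ⟨hc, hc'⟩ := hc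
  simp only at ha hb hc ha' hb' hc'
  have comm : ∀ {a b c : ℍ[ℝ]}, a.re = 0 → b.re = 0 → c.re = 0 →
      a * b + c - (((a * b + c).re : ℝ) : ℍ[ℝ]) = c + (1 / 2 : ℝ) • (a * b - b * a) := by
    intro a b c ha hb hc
    ext <;> simp [ha, hb, hc] <;> ring
  simp only [Prod.mk_mul_mk, Prod.mk_add_mk]
  rw [tanProj_mul hp hq, diffTensor_mul hp hq, comm ha hb hc, comm ha' hb' hc', Prod.mk_add_mk,
    ← mul_add, ← mul_add]
  refine Prod.ext ?_ ?_ <;> simp only [omega_apply, Prod.mk_mul_mk, Prod.mk_add_mk] <;> congr 1 <;>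
    module

theorem leftExt_mul {x : HH} (hx : OnS x) (b y : HH) : leftExt x (x * b) y = y * b := by
  refine Prod.ext ?_ ?_ <;> simp [leftExt, mul_assoc, hx.ne_zero.1, hx.ne_zero.2]

/-- The identity of ℍ × ℍ leaves the product of spheres, but the formula for `nabla` only needs the
base point x to lie on it. -/
theorem nabla_id_mul {x : HH} (hx : OnS x) {a c : HH} (ha : IsIm a) (hc : IsIm c)
    {ξ : HH → HH} (hξ : ∀ᶠ y in nhds x, ξ y = y * c) :
    nabla (fun y => y) ξ x (x * a) = x * omega a c := by
  have h1 : fderiv ℝ ξ x (x * a) = x * a * c := by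
    have h2 : ξ =ᶠ[nhds x] fun y => y * c := hξ
    rw [h2.fderiv_eq, fderiv_mul_const' differentiableAt_id]
    simp
  have h0 : IsIm (0 : HH) := ⟨rfl, rfl⟩
  have := nabla_of_eq (u := fun y : HH => y) (ξ := ξ) (t := x) (X := x * a) (a := a) (b := c)
    (c := 0) hx ha hc h0 (by simp) hξ.self_of_nhds (by rw [h1, add_zero, mul_assoc])
  rwa [zero_add] at this

/-- A tensor with constant coefficients τ in the left-invariant frame has covariant derivative
[ω(a), τ]. The hypothesis on T concerns all pairs of nonzero quaternions because `covDeriv`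
differentiates on an open subset of ℍ × ℍ, not only along the spheres. -/
theorem covDeriv_mul {T : HH → HH → HH} {τ : HH →ₗ[ℝ] HH}
    (hT : ∀ y : HH, y.1 ≠ 0 ∧ y.2 ≠ 0 → ∀ a, T y (y * a) = y * τ a)
    (hτ : ∀ a, IsIm a → IsIm (τ a)) {x : HH} (hx : OnS x) {a b : HH} (ha : IsIm a) (hb : IsIm b) :
    covDeriv T x (x * a) (x * b) = x * (omega a (τ b) - τ (omega a b)) := by
  have hne : ∀ᶠ y : HH in nhds x, y.1 ≠ 0 ∧ y.2 ≠ 0 :=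
    (continuous_fst.continuousAt.eventually_ne hx.ne_zero.1).and
      (continuous_snd.continuousAt.eventually_ne hx.ne_zero.2)
  rw [covDeriv, nabla_id_mul hx ha hb (.of_forall fun y => leftExt_mul hx b y),
    nabla_id_mul hx ha (hτ b hb) (hne.mono fun y hy => by rw [leftExt_mul hx, hT y hy]),
    hT x hx.ne_zero, mul_sub]

theorem G_mul {x : HH} (hx : OnS x) {a b : HH} (ha : IsIm a) (hb : IsIm b) :
    G x (x * a) (x * b) = x * invG a b := by
  rw [G, covDeriv_mul (fun y hy => J_mul hy) (fun _ => isIm_invJ) hx ha hb, invG_eq]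

theorem isTangent_G {x w v : HH} (hx : OnS x) (hw : IsTangent x w) (hv : IsTangent x v) :
    IsTangent x (G x w v) := by
  obtain ⟨a, ha, rfl⟩ := hw.exists_eq_mul hx
  obtain ⟨b, hb, rfl⟩ := hv.exists_eq_mul hx
  rw [G_mul hx ha hb, isTangent_mul_iff hx]
  exact isIm_invG a

theorem G_antisymm {x w v : HH} (hx : OnS x) (hw : IsTangent x w) (hv : IsTangent x v) :
    G x w v = -G x v w := by
  obtain ⟨a, ha, rfl⟩ := hw.exists_eq_mul hx
  obtain ⟨b, hb, rfl⟩ := hv.exists_eq_mul hx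
  rw [G_mul hx ha hb, G_mul hx hb ha, invG_antisymm ha hb, mul_neg]

theorem G_add_right {x w v v' : HH} (hx : OnS x) (hw : IsTangent x w) (hv : IsTangent x v)
    (hv' : IsTangent x v') : G x w (v + v') = G x w v + G x w v' := by
  obtain ⟨a, ha, rfl⟩ := hw.exists_eq_mul hx
  obtain ⟨b, hb, rfl⟩ := hv.exists_eq_mul hx
  obtain ⟨c, hc, rfl⟩ := hv'.exists_eq_mul hx
  rw [← mul_add, G_mul hx ha hb, G_mul hx ha hc, G_mul hx ha, map_add, mul_add]
  simp [IsIm, hb.1, hb.2, hc.1, hc.2]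

theorem G_add_left {x w w' v : HH} (hx : OnS x) (hw : IsTangent x w) (hw' : IsTangent x w')
    (hv : IsTangent x v) : G x (w + w') v = G x w v + G x w' v := by
  rw [G_antisymm hx (hw.add hw') hv, G_add_right hx hv hw hw', G_antisymm hx hw hv,
    G_antisymm hx hw' hv, neg_add]

theorem g_G_left {x w v z : HH} (hx : OnS x) (hw : IsTangent x w) (hv : IsTangent x v)
    (hz : IsTangent x z) : g x (G x w v) z = -g x v (G x w z) := by
  obtain ⟨a, ha, rfl⟩ := hw.exists_eq_mul hx
  obtain ⟨b, hb, rfl⟩ := hv.exists_eq_mul hx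
  obtain ⟨c, hc, rfl⟩ := hz.exists_eq_mul hx
  rw [G_mul hx ha hb, G_mul hx ha hc, g_mul hx, g_mul hx, invg_invG_left ha hb hc]

theorem G_J {x w v : HH} (hx : OnS x) (hw : IsTangent x w) (hv : IsTangent x v) :
    G x w (J x v) = -J x (G x w v) := by
  obtain ⟨a, ha, rfl⟩ := hw.exists_eq_mul hx
  obtain ⟨b, hb, rfl⟩ := hv.exists_eq_mul hx
  rw [G_mul hx ha hb, J_mul hx.ne_zero, J_mul hx.ne_zero, G_mul hx ha (isIm_invJ hb),
    invG_invJ ha hb, mul_neg]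

/-- The curvature tensor of `∇̃`. -/
def curvS (x X Y Z : HH) : HH :=
  (5 / 12 : ℝ) • (g x Y Z • X - g x X Z • Y)
  + (1 / 12 : ℝ) • (g x (J x Y) Z • J x X - g x (J x X) Z • J x Y - (2 * g x (J x X) Y) • J x Z)
  + (1 / 3 : ℝ) • (g x (P x Y) Z • P x X - g x (P x X) Z • P x Y
      + g x (J x (P x Y)) Z • J x (P x X) - g x (J x (P x X)) Z • J x (P x Y))

theorem curvS_mul {x : HH} (hx : OnS x) {a b c : HH} (ha : IsIm a) (hb : IsIm b) (hc : IsIm c) :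
    curvS x (x * a) (x * b) (x * c) =
      x * (omega a (omega b c) - omega b (omega a c) - omega (a * b - b * a) c) := by
  rw [omega_curvature ha hb hc]
  simp only [curvS, P_mul hx.ne_zero, J_mul hx.ne_zero, g_mul hx, mul_add, mul_sub, mul_smul_comm]

/-! ### Smooth maps to `𝕊³ × 𝕊³` and vector fields along them -/

variable {E : Type*} [NormedAddCommGroup E] [NormedSpace ℝ E]

/-- `u` is a smooth map to `𝕊³ × 𝕊³` on the open set `O`. -/
structure IsMapOn (u : E → HH) (O : Set E) : Prop where
  isOpen : IsOpen O
  smooth : ContDiffOn ℝ ∞ u O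
  onS : ∀ s ∈ O, OnS (u s)

/-- `ξ` is a smooth field of tangent vectors of `𝕊³ × 𝕊³` along `u` on `O`. -/
structure IsFieldOn (u : E → HH) (O : Set E) (ξ : E → HH) : Prop where
  smooth : ContDiffOn ℝ ∞ ξ O
  tangent : ∀ s ∈ O, IsTangent (u s) (ξ s)

theorem differentiableAt_of_contDiffOn {F : Type*} [NormedAddCommGroup F] [NormedSpace ℝ F]
    {O : Set E} (hO : IsOpen O) {f : E → F} (hf : ContDiffOn ℝ ∞ f O) {t : E} (ht : t ∈ O) :
    DifferentiableAt ℝ f t :=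
  (hf.contDiffAt (hO.mem_nhds ht)).differentiableAt (by simp)

theorem contDiffOn_fderiv_apply {F : Type*} [NormedAddCommGroup F] [NormedSpace ℝ F]
    {O : Set E} (hO : IsOpen O) {f : E → F} (hf : ContDiffOn ℝ ∞ f O) {X : E → E}
    (hX : ContDiffOn ℝ ∞ X O) : ContDiffOn ℝ ∞ (fun s => fderiv ℝ f s (X s)) O :=
  ((contDiffOn_infty_iff_fderiv_of_isOpen hO).1 hf).2.clm_apply hX

theorem contDiffOn_bilinear {F F' F'' : Type*} [NormedAddCommGroup F] [NormedSpace ℝ F]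
    [NormedAddCommGroup F'] [NormedSpace ℝ F'] [NormedAddCommGroup F''] [NormedSpace ℝ F'']
    [FiniteDimensional ℝ F] [FiniteDimensional ℝ F'] (B : F →ₗ[ℝ] F' →ₗ[ℝ] F'')
    {O : Set E} {f : E → F} {f' : E → F'} (hf : ContDiffOn ℝ ∞ f O) (hf' : ContDiffOn ℝ ∞ f' O) :
    ContDiffOn ℝ ∞ (fun s => B (f s) (f' s)) O :=
  (B.toContinuousBilinearMap.contDiff.comp_contDiffOn hf).clm_apply hf'

theorem contDiffOn_linear {F F' : Type*} [NormedAddCommGroup F] [NormedSpace ℝ F]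
    [NormedAddCommGroup F'] [NormedSpace ℝ F'] [FiniteDimensional ℝ F] (B : F →ₗ[ℝ] F')
    {O : Set E} {f : E → F} (hf : ContDiffOn ℝ ∞ f O) : ContDiffOn ℝ ∞ (fun s => B (f s)) O :=
  (LinearMap.toContinuousLinearMap B).contDiff.comp_contDiffOn hf

theorem fderiv_linear {F F' : Type*} [NormedAddCommGroup F] [NormedSpace ℝ F]
    [NormedAddCommGroup F'] [NormedSpace ℝ F'] [FiniteDimensional ℝ F] (B : F →ₗ[ℝ] F')
    {f : E → F} {t : E} (hf : DifferentiableAt ℝ f t) (X : E) :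
    fderiv ℝ (fun s => B (f s)) t X = B (fderiv ℝ f t X) := by
  have := ((LinearMap.toContinuousLinearMap B).hasFDerivAt.comp t hf.hasFDerivAt).fderiv
  exact DFunLike.congr_fun this X

theorem fderiv_bilinear {F F' F'' : Type*} [NormedAddCommGroup F] [NormedSpace ℝ F]
    [NormedAddCommGroup F'] [NormedSpace ℝ F'] [NormedAddCommGroup F''] [NormedSpace ℝ F'']
    [FiniteDimensional ℝ F] [FiniteDimensional ℝ F'] (B : F →ₗ[ℝ] F' →ₗ[ℝ] F'')
    {f : E → F} {f' : E → F'} {t : E} (hf : DifferentiableAt ℝ f t) (hf' : DifferentiableAt ℝ f' t)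
    (X : E) :
    fderiv ℝ (fun s => B (f s) (f' s)) t X = B (fderiv ℝ f t X) (f' t) + B (f t) (fderiv ℝ f' t X) := by
  have h1 := (B.toContinuousBilinearMap.hasFDerivAt.comp t hf.hasFDerivAt).clm_apply hf'.hasFDerivAt
  have := DFunLike.congr_fun h1.fderiv X
  simp only [Function.comp_def, LinearMap.toContinuousBilinearMap_apply] at this
  rw [this]
  simp [add_comm]

/-- Conjugation on `ℍ × ℍ`. -/
def starLin : HH →ₗ[ℝ] HH where
  toFun := star
  map_add' := star_add
  map_smul' r x := by ext <;> simp

/-- The coordinates of a vector field along `u` in the left-invariant frame. -/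
def triv (u ξ : E → HH) (s : E) : HH := star (u s) * ξ s

theorem contDiffOn_triv {u ξ : E → HH} {O : Set E} (hu : ContDiffOn ℝ ∞ u O)
    (hξ : ContDiffOn ℝ ∞ ξ O) : ContDiffOn ℝ ∞ (triv u ξ) O :=
  (contDiffOn_linear starLin hu).mul hξ

namespace IsMapOn

variable {u ξ η : E → HH} {O : Set E} {t : E}

theorem differentiableAt (hu : IsMapOn u O) (ht : t ∈ O) : DifferentiableAt ℝ u t :=
  differentiableAt_of_contDiffOn hu.isOpen hu.smooth ht

theorem eventually_mem (hu : IsMapOn u O) (ht : t ∈ O) : ∀ᶠ s in nhds t, s ∈ O :=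
  hu.isOpen.mem_nhds ht

theorem isField_fderiv (hu : IsMapOn u O) {X : E → E} (hX : ContDiffOn ℝ ∞ X O) :
    IsFieldOn u O (fun s => fderiv ℝ u s (X s)) :=
  ⟨contDiffOn_fderiv_apply hu.isOpen hu.smooth hX, fun _ hs =>
    fderiv_onS (hu.differentiableAt hs) ((hu.eventually_mem hs).mono hu.onS) _⟩

theorem isField_fderiv_const (hu : IsMapOn u O) (X : E) :
    IsFieldOn u O (fun s => fderiv ℝ u s X) := hu.isField_fderiv contDiffOn_const

theorem field_differentiableAt (hu : IsMapOn u O) (hξ : IsFieldOn u O ξ) (ht : t ∈ O) :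
    DifferentiableAt ℝ ξ t :=
  differentiableAt_of_contDiffOn hu.isOpen hξ.smooth ht

theorem mul_triv (hu : IsMapOn u O) (ht : t ∈ O) (ξ : E → HH) : u t * triv u ξ t = ξ t :=
  mul_star_mul_of_onS (hu.onS t ht) _

theorem triv_differentiableAt (hu : IsMapOn u O) (hξ : IsFieldOn u O ξ) (ht : t ∈ O) :
    DifferentiableAt ℝ (triv u ξ) t :=
  differentiableAt_of_contDiffOn hu.isOpen (contDiffOn_triv hu.smooth hξ.smooth) ht

theorem isIm_triv (hu : IsMapOn u O) (hξ : IsFieldOn u O ξ) (ht : t ∈ O) : IsIm (triv u ξ t) :=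
  isIm_star_mul (hu.onS t ht) (hξ.tangent t ht)

/-- The real parts are linear functionals that vanish on the coordinates throughout the open set,
hence also on their derivative. -/
theorem isIm_fderiv_triv (hu : IsMapOn u O) (hξ : IsFieldOn u O ξ) (ht : t ∈ O) (X : E) :
    IsIm (fderiv ℝ (triv u ξ) t X) := by
  have hd := hu.triv_differentiableAt hξ ht
  let r₁ : HH →ₗ[ℝ] ℝ := { toFun := fun a => a.1.re, map_add' := by simp, map_smul' := by simp }
  let r₂ : HH →ₗ[ℝ] ℝ := { toFun := fun a => a.2.re, map_add' := by simp, map_smul' := by simp }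
  have h0 : ∀ r : HH →ₗ[ℝ] ℝ, (∀ s ∈ O, r (triv u ξ s) = 0) → r (fderiv ℝ (triv u ξ) t X) = 0 := by
    intro r hr
    rw [← fderiv_linear r hd]
    have : (fun s => r (triv u ξ s)) =ᶠ[nhds t] fun _ => 0 := (hu.eventually_mem ht).mono hr
    rw [this.fderiv_eq]
    simp
  exact ⟨h0 r₁ fun s hs => (hu.isIm_triv hξ hs).1, h0 r₂ fun s hs => (hu.isIm_triv hξ hs).2⟩

/-- The product rule for ξ = u * α gives dξ = u * (a * α + dα), so the connection is d + ω in the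
left-invariant frame. Every rule for `nabla` on tensor fields and every curvature computation below
goes through this formula. -/
theorem nabla_eq (hu : IsMapOn u O) (hξ : IsFieldOn u O ξ) (ht : t ∈ O) (X : E) :
    nabla u ξ t X = u t * (fderiv ℝ (triv u ξ) t X +
      omega (triv u (fun s => fderiv ℝ u s X) t) (triv u ξ t)) := by
  refine nabla_of_eq (hu.onS t ht) (hu.isIm_triv (hu.isField_fderiv_const X) ht)
    (hu.isIm_triv hξ ht) (hu.isIm_fderiv_triv hξ ht X)
    (hu.mul_triv ht (fun s => fderiv ℝ u s X)).symm (hu.mul_triv ht ξ).symm ?_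
  have h1 : ξ =ᶠ[nhds t] fun s => u s * triv u ξ s :=
    (hu.eventually_mem ht).mono fun s hs => (hu.mul_triv hs ξ).symm
  rw [h1.fderiv_eq, fderiv_fun_mul' (hu.differentiableAt ht) (hu.triv_differentiableAt hξ ht)]
  have h2 := hu.mul_triv ht (fun s => fderiv ℝ u s X)
  simp only [_root_.add_apply, _root_.smul_apply,
    MulOpposite.smul_eq_mul_unop, MulOpposite.unop_op, smul_eq_mul]
  rw [mul_add, ← mul_assoc, h2, add_comm]

theorem isField_mul (hu : IsMapOn u O) {α : E → HH} (hα : ContDiffOn ℝ ∞ α O)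
    (him : ∀ s ∈ O, IsIm (α s)) (hξ : ∀ s ∈ O, ξ s = u s * α s) : IsFieldOn u O ξ :=
  ⟨(hu.smooth.mul hα).congr hξ, fun s hs => by
    rw [hξ s hs, isTangent_mul_iff (hu.onS s hs)]; exact him s hs⟩

theorem triv_eq (hu : IsMapOn u O) (ht : t ∈ O) {a : HH} (hξ : ξ t = u t * a) : triv u ξ t = a := by
  rw [triv, hξ, star_mul_mul_of_onS (hu.onS t ht)]

theorem fderiv_triv_eq (hu : IsMapOn u O) (ht : t ∈ O) {α : E → HH}
    (hξ : ∀ s ∈ O, ξ s = u s * α s) : fderiv ℝ (triv u ξ) t = fderiv ℝ α t :=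
  Filter.EventuallyEq.fderiv_eq
    ((hu.eventually_mem ht).mono fun s hs => hu.triv_eq hs (hξ s hs))

theorem isField_nabla (hu : IsMapOn u O) (hξ : IsFieldOn u O ξ) (X : E) :
    IsFieldOn u O (fun s => nabla u ξ s X) := by
  have h1 := contDiffOn_triv hu.smooth hξ.smooth
  have hX := hu.isField_fderiv_const X
  refine hu.isField_mul ((contDiffOn_fderiv_apply hu.isOpen h1 contDiffOn_const).add
    (contDiffOn_bilinear omega (contDiffOn_triv hu.smooth hX.smooth) h1)) ?_
    fun s hs => hu.nabla_eq hξ hs X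
  intro s hs
  have h2 := hu.isIm_fderiv_triv hξ hs X
  have h3 := isIm_omega (triv u (fun s => fderiv ℝ u s X) s) (triv u ξ s)
  simp [IsIm, h2.1, h2.2, h3.1, h3.2]

theorem isField_linear (hu : IsMapOn u O) (hξ : IsFieldOn u O ξ) {T : HH → HH → HH}
    {τ : HH →ₗ[ℝ] HH} (hT : ∀ y : HH, y.1 ≠ 0 ∧ y.2 ≠ 0 → ∀ a, T y (y * a) = y * τ a)
    (hτ : ∀ a, IsIm a → IsIm (τ a)) : IsFieldOn u O (fun s => T (u s) (ξ s)) :=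
  hu.isField_mul (contDiffOn_linear τ (contDiffOn_triv hu.smooth hξ.smooth))
    (fun _ hs => hτ _ (hu.isIm_triv hξ hs))
    (fun s hs => by rw [← hT _ (hu.onS s hs).ne_zero, hu.mul_triv hs])

/-- In the frame both sides are dτα + ω(a)τα, because τ is constant. This connects `covDeriv`,
defined by left-invariant extensions, with arbitrary fields along u. -/
theorem nabla_linear (hu : IsMapOn u O) (hξ : IsFieldOn u O ξ) (ht : t ∈ O) {T : HH → HH → HH}
    {τ : HH →ₗ[ℝ] HH} (hT : ∀ y : HH, y.1 ≠ 0 ∧ y.2 ≠ 0 → ∀ a, T y (y * a) = y * τ a)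
    (hτ : ∀ a, IsIm a → IsIm (τ a)) (X : E) :
    nabla u (fun s => T (u s) (ξ s)) t X =
      T (u t) (nabla u ξ t X) + covDeriv T (u t) (fderiv ℝ u t X) (ξ t) := by
  have hX := hu.isField_fderiv_const X
  have e : ∀ s ∈ O, T (u s) (ξ s) = u s * τ (triv u ξ s) := fun s hs => by
    rw [← hT _ (hu.onS s hs).ne_zero, hu.mul_triv hs]
  have h1 := covDeriv_mul hT hτ (hu.onS t ht) (hu.isIm_triv hX ht) (hu.isIm_triv hξ ht)
  rw [hu.mul_triv ht, hu.mul_triv ht] at h1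
  rw [h1, hu.nabla_eq (hu.isField_linear hξ hT hτ) ht, hu.nabla_eq hξ ht,
    hu.triv_eq (ξ := fun s => T (u s) (ξ s)) ht (e t ht), hu.fderiv_triv_eq ht e, hT _ (hu.onS t ht).ne_zero,
    fderiv_linear τ (hu.triv_differentiableAt hξ ht), ← mul_add, map_add]
  congr 1
  abel

theorem isField_J (hu : IsMapOn u O) (hξ : IsFieldOn u O ξ) :
    IsFieldOn u O (fun s => J (u s) (ξ s)) :=
  hu.isField_linear hξ (fun _ => J_mul) (fun _ => isIm_invJ)

theorem isField_P (hu : IsMapOn u O) (hξ : IsFieldOn u O ξ) :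
    IsFieldOn u O (fun s => P (u s) (ξ s)) :=
  hu.isField_linear hξ (fun _ => P_mul) (fun _ => isIm_invP)

theorem isField_PJ (hu : IsMapOn u O) (hξ : IsFieldOn u O ξ) :
    IsFieldOn u O (fun s => PJ (u s) (ξ s)) := hu.isField_P (hu.isField_J hξ)

theorem nabla_J (hu : IsMapOn u O) (hξ : IsFieldOn u O ξ) (ht : t ∈ O) (X : E) :
    nabla u (fun s => J (u s) (ξ s)) t X =
      J (u t) (nabla u ξ t X) + G (u t) (fderiv ℝ u t X) (ξ t) :=
  hu.nabla_linear hξ ht (fun _ => J_mul) (fun _ => isIm_invJ) X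

theorem nabla_P (hu : IsMapOn u O) (hξ : IsFieldOn u O ξ) (ht : t ∈ O) (X : E) :
    nabla u (fun s => P (u s) (ξ s)) t X =
      P (u t) (nabla u ξ t X) + covDeriv P (u t) (fderiv ℝ u t X) (ξ t) :=
  hu.nabla_linear hξ ht (fun _ => P_mul) (fun _ => isIm_invP) X

theorem nabla_PJ (hu : IsMapOn u O) (hξ : IsFieldOn u O ξ) (ht : t ∈ O) (X : E) :
    nabla u (fun s => PJ (u s) (ξ s)) t X =
      PJ (u t) (nabla u ξ t X) + covDeriv PJ (u t) (fderiv ℝ u t X) (ξ t) :=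
  hu.nabla_linear hξ ht (fun _ => PJ_mul) (fun _ h => isIm_invP (isIm_invJ h)) X

theorem isField_G (hu : IsMapOn u O) (hξ : IsFieldOn u O ξ) (hη : IsFieldOn u O η) :
    IsFieldOn u O (fun s => G (u s) (ξ s) (η s)) :=
  hu.isField_mul (contDiffOn_bilinear invG (contDiffOn_triv hu.smooth hξ.smooth)
    (contDiffOn_triv hu.smooth hη.smooth)) (fun _ _ => isIm_invG _) fun s hs => by
      rw [← G_mul (hu.onS s hs) (hu.isIm_triv hξ hs) (hu.isIm_triv hη hs), hu.mul_triv hs,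
        hu.mul_triv hs]

/-- The last summand is the covariant derivative of G itself, given algebraically by
`invG_covDeriv`. -/
theorem nabla_G (hu : IsMapOn u O) (hξ : IsFieldOn u O ξ) (hη : IsFieldOn u O η) (ht : t ∈ O)
    (X : E) :
    nabla u (fun s => G (u s) (ξ s) (η s)) t X =
      G (u t) (nabla u ξ t X) (η t) + G (u t) (ξ t) (nabla u η t X) +
      (1 / 3 : ℝ) • (g (u t) (fderiv ℝ u t X) (η t) • J (u t) (ξ t)
        - g (u t) (fderiv ℝ u t X) (ξ t) • J (u t) (η t)
        - g (u t) (J (u t) (ξ t)) (η t) • fderiv ℝ u t X) := by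
  have hX := hu.isField_fderiv_const X
  have e : ∀ s ∈ O, G (u s) (ξ s) (η s) = u s * invG (triv u ξ s) (triv u η s) := fun s hs => by
    rw [← G_mul (hu.onS s hs) (hu.isIm_triv hξ hs) (hu.isIm_triv hη hs), hu.mul_triv hs,
      hu.mul_triv hs]
  have hS := hu.onS t ht
  rw [hu.nabla_eq (hu.isField_G hξ hη) ht,
    hu.triv_eq (ξ := fun s => G (u s) (ξ s) (η s)) ht (e t ht), hu.fderiv_triv_eq ht e,
    fderiv_bilinear invG (hu.triv_differentiableAt hξ ht) (hu.triv_differentiableAt hη ht),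
    hu.nabla_eq hξ ht, hu.nabla_eq hη ht]
  have h1 := hu.isIm_triv hX ht
  have h2 := hu.isIm_triv hξ ht
  have h3 := hu.isIm_triv hη ht
  have h4 := hu.isIm_fderiv_triv hξ ht X
  have h5 := hu.isIm_fderiv_triv hη ht X
  have key := invG_covDeriv h1 h2 h3
  have eX := hu.mul_triv ht (fun s => fderiv ℝ u s X)
  rw [← eX, ← hu.mul_triv ht ξ, ← hu.mul_triv ht η]
  generalize triv u (fun s => fderiv ℝ u s X) t = a at *
  generalize fderiv ℝ (triv u ξ) t X = b' at *
  generalize fderiv ℝ (triv u η) t X = c' at *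
  generalize triv u ξ t = b at *
  generalize triv u η t = c at *
  have im_add : ∀ {a b : HH}, IsIm a → IsIm b → IsIm (a + b) := fun ha hb => by
    simp [IsIm, ha.1, ha.2, hb.1, hb.2]
  rw [G_mul hS (im_add h4 (isIm_omega a b)) h3, G_mul hS h2 (im_add h5 (isIm_omega a c)),
    J_mul hS.ne_zero, J_mul hS.ne_zero, g_mul hS, g_mul hS, g_mul hS, ← mul_smul_comm,
    ← mul_smul_comm, ← mul_smul_comm, ← mul_sub, ← mul_sub, ← mul_smul_comm, ← key, ← mul_add,
    ← mul_add, map_add, map_add, LinearMap.add_apply]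
  congr 1
  abel

/-- This is the Maurer–Cartan equation for the left-invariant form star u * du. It follows from the
vanishing of torsion, because the skew part of ω is the commutator: ω(a, b) - ω(b, a) = ab - ba. -/
theorem fderiv_triv_fderiv (hu : IsMapOn u O) (ht : t ∈ O) (X Y : E) :
    fderiv ℝ (triv u (fun s => fderiv ℝ u s Y)) t X - fderiv ℝ (triv u (fun s => fderiv ℝ u s X)) t Y
      = -(triv u (fun s => fderiv ℝ u s X) t * triv u (fun s => fderiv ℝ u s Y) t
        - triv u (fun s => fderiv ℝ u s Y) t * triv u (fun s => fderiv ℝ u s X) t) := by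
  have htf : nabla u (fun s => fderiv ℝ u s Y) t X = nabla u (fun s => fderiv ℝ u s X) t Y :=
    nabla_torsionFree ((hu.smooth.contDiffAt (hu.isOpen.mem_nhds ht)).of_le (by norm_cast)) X Y
  have hX := hu.isField_fderiv_const X
  have hY := hu.isField_fderiv_const Y
  rw [hu.nabla_eq hY ht, hu.nabla_eq hX ht] at htf
  have h1 := congrArg (fun w => star (u t) * w) htf
  simp only [star_mul_mul_of_onS (hu.onS t ht)] at h1
  have h2 : ∀ a b : HH, omega a b - omega b a = a * b - b * a := fun a b => by
    refine Prod.ext ?_ ?_ <;> simp only [omega_apply, Prod.fst_sub, Prod.snd_sub, Prod.fst_mul,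
      Prod.snd_mul] <;> module
  rw [← h2]
  rw [neg_sub, sub_eq_sub_iff_add_eq_add, h1, add_comm]

/-- The Ricci identity for vector fields along `u`. -/
theorem nabla_nabla_sub (hu : IsMapOn u O) (hξ : IsFieldOn u O ξ) (ht : t ∈ O) (X Y : E) :
    nabla u (fun s => nabla u ξ s Y) t X - nabla u (fun s => nabla u ξ s X) t Y =
      curvS (u t) (fderiv ℝ u t X) (fderiv ℝ u t Y) (ξ t) := by
  have hX := hu.isField_fderiv_const X
  have hY := hu.isField_fderiv_const Y
  have hα := contDiffOn_triv hu.smooth hξ.smooth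
  have key : ∀ X Y : E, nabla u (fun s => nabla u ξ s Y) t X =
      u t * (fderiv ℝ (fun s => fderiv ℝ (triv u ξ) s Y) t X
        + (omega (fderiv ℝ (triv u (fun s => fderiv ℝ u s Y)) t X) (triv u ξ t)
          + omega (triv u (fun s => fderiv ℝ u s Y) t) (fderiv ℝ (triv u ξ) t X))
        + omega (triv u (fun s => fderiv ℝ u s X) t) (fderiv ℝ (triv u ξ) t Y
          + omega (triv u (fun s => fderiv ℝ u s Y) t) (triv u ξ t))) := by
    intro X Y
    have hY := hu.isField_fderiv_const Y
    have d1 := hu.triv_differentiableAt hY ht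
    have d2 := hu.triv_differentiableAt hξ ht
    have d3 : DifferentiableAt ℝ (fun s => fderiv ℝ (triv u ξ) s Y) t :=
      differentiableAt_of_contDiffOn hu.isOpen
        (contDiffOn_fderiv_apply hu.isOpen hα contDiffOn_const) ht
    have d4 : DifferentiableAt ℝ
        (fun s => omega (triv u (fun s => fderiv ℝ u s Y) s) (triv u ξ s)) t :=
      differentiableAt_of_contDiffOn hu.isOpen
        (contDiffOn_bilinear omega (contDiffOn_triv hu.smooth hY.smooth) hα) ht
    rw [hu.nabla_eq (hu.isField_nabla hξ Y) ht,
      hu.fderiv_triv_eq ht fun s hs => hu.nabla_eq hξ hs Y, 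
      hu.triv_eq (ξ := fun s => nabla u ξ s Y) ht (hu.nabla_eq hξ ht Y),
      fderiv_fun_add d3 d4, _root_.add_apply, fderiv_bilinear omega d1 d2]
  have hsymm : fderiv ℝ (fun s => fderiv ℝ (triv u ξ) s Y) t X =
      fderiv ℝ (fun s => fderiv ℝ (triv u ξ) s X) t Y := by
    have hc := hα.contDiffAt (hu.isOpen.mem_nhds ht)
    have hd : DifferentiableAt ℝ (fderiv ℝ (triv u ξ)) t :=
      (hc.fderiv_right (m := 1) (by norm_cast)).differentiableAt (by norm_num)
    rw [fderiv_clm_apply hd (differentiableAt_const _), fderiv_clm_apply hd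
      (differentiableAt_const _)]
    simpa using (hc.isSymmSndFDerivAt (by simp; norm_cast)) X Y
  have hmc := hu.fderiv_triv_fderiv ht X Y
  have hR := curvS_mul (hu.onS t ht) (hu.isIm_triv hX ht) (hu.isIm_triv hY ht) (hu.isIm_triv hξ ht)
  rw [hu.mul_triv ht, hu.mul_triv ht, hu.mul_triv ht] at hR
  rw [hR, key X Y, key Y X, hsymm, ← mul_sub]
  congr 1
  -- The second derivatives of the coordinates of ξ have cancelled by symmetry. The Maurer–Cartan
  -- equation trades the commutator inside ω for the skew part of the derivative of the frame
  -- components of du.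
  rw [← neg_eq_iff_eq_neg.2 hmc]
  simp only [map_add, map_neg, map_sub, LinearMap.neg_apply, LinearMap.sub_apply]
  abel

theorem contDiffOn_g (hu : IsMapOn u O) (hξ : IsFieldOn u O ξ) (hη : IsFieldOn u O η) :
    ContDiffOn ℝ ∞ (fun s => g (u s) (ξ s) (η s)) O := by
  have h1 := contDiffOn_triv hu.smooth hξ.smooth
  have h2 := contDiffOn_triv hu.smooth hη.smooth
  have h : ContDiffOn ℝ ∞ (fun s => invg (triv u ξ s) (triv u η s)) O :=
    (contDiffOn_const.mul ((h1.fst.inner ℝ h2.fst).add (h1.snd.inner ℝ h2.snd))).sub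
      (contDiffOn_const.mul ((h1.fst.inner ℝ h2.snd).add (h2.fst.inner ℝ h1.snd)))
  exact h.congr fun s hs => by rw [← g_mul (hu.onS s hs), hu.mul_triv hs, hu.mul_triv hs]

theorem fderiv_g (hu : IsMapOn u O) (hξ : IsFieldOn u O ξ) (hη : IsFieldOn u O η) (ht : t ∈ O)
    (X : E) : fderiv ℝ (fun s => g (u s) (ξ s) (η s)) t X =
      g (u t) (nabla u ξ t X) (η t) + g (u t) (ξ t) (nabla u η t X) :=
  fderiv_g_eq (hu.differentiableAt ht) (hu.field_differentiableAt hξ ht)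
    (hu.field_differentiableAt hη ht) ((hu.eventually_mem ht).mono hu.onS)
    ((hu.eventually_mem ht).mono hξ.tangent) ((hu.eventually_mem ht).mono hη.tangent) X

theorem nabla_add (hu : IsMapOn u O) (hξ : IsFieldOn u O ξ) (hη : IsFieldOn u O η) (ht : t ∈ O)
    (X : E) : nabla u (fun s => ξ s + η s) t X = nabla u ξ t X + nabla u η t X := by
  have hs : IsFieldOn u O (fun s => ξ s + η s) :=
    ⟨hξ.smooth.add hη.smooth, fun s hs => (hξ.tangent s hs).add (hη.tangent s hs)⟩
  have e : triv u (fun s => ξ s + η s) = fun s => triv u ξ s + triv u η s := by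
    funext s; simp [triv, mul_add]
  rw [hu.nabla_eq hs ht, hu.nabla_eq hξ ht, hu.nabla_eq hη ht, e,
    fderiv_fun_add (hu.triv_differentiableAt hξ ht) (hu.triv_differentiableAt hη ht), ← mul_add]
  congr 1
  simp only [map_add, _root_.add_apply]
  abel

theorem nabla_congr (hu : IsMapOn u O) (ht : t ∈ O) (h : ∀ s ∈ O, ξ s = η s) (X : E) :
    nabla u ξ t X = nabla u η t X := by
  have : ξ =ᶠ[nhds t] η := (hu.eventually_mem ht).mono h
  rw [nabla, nabla, this.fderiv_eq, h t ht]

end IsMapOn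

/-! ### Lagrangian immersions in local coordinates -/

/-- `u` parametrizes a Lagrangian submanifold of `𝕊³ × 𝕊³` on the open set `O`. -/
structure IsLagrangianOn (u : E3 → HH) (O : Set E3) : Prop extends IsMapOn u O where
  injective : ∀ s ∈ O, Function.Injective (fderiv ℝ u s)
  lagrangian : ∀ s ∈ O, ∀ w, IsTangent (u s) w →
    ((∃ X, J (u s) (fderiv ℝ u s X) = w) ↔ ∀ Y, g (u s) w (fderiv ℝ u s Y) = 0)

/-- `w` is a normal vector of the submanifold parametrized by `u`. -/
structure IsNormal (u : E3 → HH) (t : E3) (w : HH) : Prop where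
  tangent : IsTangent (u t) w
  g_eq_zero : ∀ Y, g (u t) w (fderiv ℝ u t Y) = 0

/-- The Christoffel symbols of the induced connection. -/
def chr (u : E3 → HH) (t X Y : E3) : E3 := conn u (fun _ => Y) t X

/-- The cubic form `g(h(X, Y), J Z)`. -/
def cubic (u : E3 → HH) (t X Y Z : E3) : ℝ := g (u t) (h u t X Y) (J (u t) (fderiv ℝ u t Z))

/-- The covariant derivative of the cubic form. -/
def covCubic (u : E3 → HH) (t X Y Z W : E3) : ℝ :=
  fderiv ℝ (fun s => cubic u s Y Z W) t X - cubic u t (chr u t X Y) Z W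
    - cubic u t Y (chr u t X Z) W - cubic u t Y Z (chr u t X W)

theorem sum_coordVec (X : E3) : ∑ i, X i • coordVec i = X := by
  ext j
  simp [coordVec, Fin.sum_univ_three]
  fin_cases j <;> simp

theorem tang_add (u : E3 → HH) (t : E3) (w w' : HH) :
    tang u t (w + w') = tang u t w + tang u t w' := by
  ext i
  simp [tang, g_add_left, mul_add, Finset.sum_add_distrib]

namespace IsLagrangianOn

variable {u : E3 → HH} {O : Set E3} {t : E3}

/-! ### Orthogonal projection onto the tangent spaces -/

theorem det_gram_ne_zero (hu : IsLagrangianOn u O) (ht : t ∈ O) : (gram u t).det ≠ 0 := by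
  intro h0
  obtain ⟨v, hv, hv0⟩ := Matrix.exists_mulVec_eq_zero_iff.2 h0
  -- A vector in the kernel of the Gram matrix is the coordinate vector of a tangent vector of
  -- length zero.
  let X : E3 := WithLp.toLp 2 v
  have hX : fderiv ℝ u t X = ∑ i, v i • fderiv ℝ u t (coordVec i) := by
    conv_lhs => rw [← sum_coordVec X]
    simp [X]
  have h1 : g (u t) (fderiv ℝ u t X) (fderiv ℝ u t X) = 0 := by
    rw [hX, g_sum_left]
    refine Finset.sum_eq_zero fun i _ => ?_
    rw [g_smul_left, g_comm, g_sum_left]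
    have := congrFun hv0 i
    simp only [Matrix.mulVec, dotProduct, gram, Matrix.of_apply, Pi.zero_apply] at this
    simp only [g_smul_left]
    rw [← this, Finset.sum_congr rfl fun j _ => ?_, this, mul_zero]
    rw [g_comm, mul_comm]
  have h2 : fderiv ℝ u t X = 0 := by
    by_contra hne
    exact (g_self_pos (hu.onS t ht) hne).ne' h1
  have h3 : X = 0 := hu.injective t ht (by rw [h2, map_zero])
  exact hv (by simpa [X] using congrArg WithLp.ofLp h3)

theorem contDiffOn_gram (hu : IsLagrangianOn u O) (i j : Fin 3) :
    ContDiffOn ℝ ∞ (fun s => gram u s i j) O :=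
  hu.contDiffOn_g (hu.isField_fderiv_const _) (hu.isField_fderiv_const _)

theorem contDiffOn_gram_inv (hu : IsLagrangianOn u O) (i j : Fin 3) :
    ContDiffOn ℝ ∞ (fun s => (gram u s)⁻¹ i j) O := by
  have hg := hu.contDiffOn_gram
  have hdet : ContDiffOn ℝ ∞ (fun s => (gram u s).det) O := by
    simp only [Matrix.det_fin_three]
    fun_prop
  have hadj : ContDiffOn ℝ ∞ (fun s => (gram u s).adjugate i j) O := by
    simp only [Matrix.adjugate_fin_three]
    fin_cases i <;> fin_cases j <;> simp <;> fun_prop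
  refine ((hdet.inv fun s hs => hu.det_gram_ne_zero hs).mul hadj).congr fun s _ => ?_
  simp [Matrix.inv_def]

theorem contDiffOn_tang (hu : IsLagrangianOn u O) {ξ : E3 → HH} (hξ : IsFieldOn u O ξ) :
    ContDiffOn ℝ ∞ (fun s => tang u s (ξ s)) O := by
  rw [contDiffOn_euclidean]
  intro i
  simp only [tang]
  exact ContDiffOn.sum fun j _ => (hu.contDiffOn_gram_inv i j).mul
    (hu.contDiffOn_g hξ (hu.isField_fderiv_const _))

theorem g_fderiv_tang (hu : IsLagrangianOn u O) (ht : t ∈ O) (w : HH) (Y : E3) :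
    g (u t) (fderiv ℝ u t (tang u t w)) (fderiv ℝ u t Y) = g (u t) w (fderiv ℝ u t Y) := by
  have key : ∀ k, g (u t) (fderiv ℝ u t (tang u t w)) (fderiv ℝ u t (coordVec k)) =
      g (u t) w (fderiv ℝ u t (coordVec k)) := by
    intro k
    have hinv : gram u t * (gram u t)⁻¹ = 1 :=
      Matrix.mul_nonsing_inv _ (isUnit_iff_ne_zero.2 (hu.det_gram_ne_zero ht))
    have h1 : ∀ j, ∑ i, gram u t k i * (gram u t)⁻¹ i j = if k = j then 1 else 0 := fun j => by
      rw [← Matrix.mul_apply, hinv, Matrix.one_apply]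
    conv_lhs => rw [← sum_coordVec (tang u t w)]
    simp only [map_sum, map_smul, g_sum_left, g_smul_left, tang, Finset.sum_mul]
    rw [Finset.sum_comm]
    have h2 : ∀ j i, (gram u t)⁻¹ i j * g (u t) w (fderiv ℝ u t (coordVec j)) *
        g (u t) (fderiv ℝ u t (coordVec i)) (fderiv ℝ u t (coordVec k)) =
        g (u t) w (fderiv ℝ u t (coordVec j)) * (gram u t k i * (gram u t)⁻¹ i j) := fun j i => by
      simp only [gram, Matrix.of_apply]
      rw [g_comm _ (fderiv ℝ u t (coordVec i))]; ring
    simp only [h2, ← Finset.mul_sum, h1]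
    simp
  have hY : fderiv ℝ u t Y = ∑ i, Y i • fderiv ℝ u t (coordVec i) := by
    conv_lhs => rw [← sum_coordVec Y]
    simp
  rw [g_comm, g_comm _ w, hY, g_sum_left, g_sum_left]
  refine Finset.sum_congr rfl fun k _ => ?_
  rw [g_smul_left, g_smul_left, g_comm, key, g_comm]

theorem fderiv_onS (hu : IsLagrangianOn u O) (ht : t ∈ O) (X : E3) :
    IsTangent (u t) (fderiv ℝ u t X) := (hu.isField_fderiv_const X).tangent t ht

/-- The difference of the two candidates is tangent and orthogonal to every tangent vector, hence
zero by positivity of g and injectivity of du. -/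
theorem tang_eq (hu : IsLagrangianOn u O) (ht : t ∈ O) {w : HH} {A : E3}
    (hA : ∀ Y, g (u t) w (fderiv ℝ u t Y) = g (u t) (fderiv ℝ u t A) (fderiv ℝ u t Y)) :
    tang u t w = A := by
  rw [← sub_eq_zero]
  refine hu.injective t ht ?_
  rw [map_zero]
  by_contra hne
  refine (g_self_pos (hu.onS t ht) hne).ne' ?_
  conv_lhs => enter [2]; rw [map_sub]
  rw [g_sub_left, hu.g_fderiv_tang ht, hA, sub_self]

theorem tang_fderiv (hu : IsLagrangianOn u O) (ht : t ∈ O) (X : E3) :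
    tang u t (fderiv ℝ u t X) = X := hu.tang_eq ht fun _ => rfl

theorem isNormal_nor (hu : IsLagrangianOn u O) (ht : t ∈ O) {w : HH} (hw : IsTangent (u t) w) :
    IsNormal u t (nor u t w) :=
  ⟨hw.sub (hu.fderiv_onS ht _), fun Y => by rw [nor, g_sub_left, hu.g_fderiv_tang ht, sub_self]⟩

theorem isField_nor (hu : IsLagrangianOn u O) {ξ : E3 → HH} (hξ : IsFieldOn u O ξ) :
    IsFieldOn u O (fun s => nor u s (ξ s)) :=
  ⟨hξ.smooth.sub (contDiffOn_fderiv_apply hu.isOpen hu.smooth (hu.contDiffOn_tang hξ)),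
    fun s hs => (hu.isNormal_nor hs (hξ.tangent s hs)).tangent⟩

theorem isNormal_J (hu : IsLagrangianOn u O) (ht : t ∈ O) (X : E3) :
    IsNormal u t (J (u t) (fderiv ℝ u t X)) := by
  have := isTangent_J (hu.onS t ht) (hu.fderiv_onS ht X)
  exact ⟨this, (hu.lagrangian t ht _ this).1 ⟨X, rfl⟩⟩

theorem _root_.NK.IsNormal.exists_eq {w : HH} (hw : IsNormal u t w) (hu : IsLagrangianOn u O)
    (ht : t ∈ O) : ∃ X, w = J (u t) (fderiv ℝ u t X) := by
  obtain ⟨X, hX⟩ := (hu.lagrangian t ht _ hw.tangent).2 hw.g_eq_zero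
  exact ⟨X, hX.symm⟩

theorem g_fderiv_normal {N : HH} (hN : IsNormal u t N) (X : E3) :
    g (u t) (fderiv ℝ u t X) N = 0 := by rw [g_comm, hN.g_eq_zero]

theorem g_J_fderiv (hu : IsLagrangianOn u O) (ht : t ∈ O) (X Y : E3) :
    g (u t) (J (u t) (fderiv ℝ u t X)) (fderiv ℝ u t Y) = 0 := (hu.isNormal_J ht X).g_eq_zero Y

theorem g_nor_normal (w : HH) {N : HH} (hN : IsNormal u t N) :
    g (u t) (nor u t w) N = g (u t) w N := by
  rw [nor, g_sub_left, g_fderiv_normal hN, sub_zero]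

theorem g_normal_J_normal (hu : IsLagrangianOn u O) (ht : t ∈ O) {N N' : HH} (hN : IsNormal u t N)
    (hN' : IsNormal u t N') : g (u t) N (J (u t) N') = 0 := by
  obtain ⟨X, rfl⟩ := hN'.exists_eq hu ht
  rw [J_J (hu.onS t ht), g_neg_right, hN.g_eq_zero, neg_zero]

/-! #### The Gauss formula -/

theorem nabla_fderiv_const (X Y : E3) : nabla u (fun s => fderiv ℝ u s Y) t X =
    fderiv ℝ u t (chr u t X Y) + h u t X Y := by
  simp [chr, conn, h, nor]

/-- Letting the coordinates of a field vary adds du applied to their derivative. This vector is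
already tangent to the product of spheres, so the ambient projection leaves it unchanged. -/
theorem nabla_fderiv_field (hu : IsLagrangianOn u O) (ht : t ∈ O) {A : E3 → E3}
    (hA : ContDiffOn ℝ ∞ A O) (X : E3) : nabla u (fun s => fderiv ℝ u s (A s)) t X =
      fderiv ℝ u t (fderiv ℝ A t X) + nabla u (fun s => fderiv ℝ u s (A t)) t X := by
  have hc := hu.smooth.contDiffAt (hu.isOpen.mem_nhds ht)
  have hd : DifferentiableAt ℝ (fderiv ℝ u) t :=
    (hc.fderiv_right (m := 1) (by norm_cast)).differentiableAt (by norm_num)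
  have hAd := differentiableAt_of_contDiffOn hu.isOpen hA ht
  have htan := hu.fderiv_onS ht (fderiv ℝ A t X)
  have hproj : ∀ w, tanProj (u t) (w + fderiv ℝ u t (fderiv ℝ A t X)) =
      tanProj (u t) w + fderiv ℝ u t (fderiv ℝ A t X) := fun w => by
    refine Prod.ext ?_ ?_
    · simp only [tanProj, Prod.fst_add, inner_add_right, htan.1, add_zero]; abel
    · simp only [tanProj, Prod.snd_add, inner_add_right, htan.2, add_zero]; abel
  simp only [nabla]
  rw [fderiv_clm_apply hd hAd, fderiv_clm_apply hd (differentiableAt_const _)]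
  simp only [_root_.add_apply, ContinuousLinearMap.comp_apply, ContinuousLinearMap.flip_apply]
  rw [add_comm (fderiv ℝ u t (fderiv ℝ A t X)), hproj]
  simp
  abel

theorem conn_eq (hu : IsLagrangianOn u O) (ht : t ∈ O) {A : E3 → E3}
    (hA : ContDiffOn ℝ ∞ A O) (X : E3) :
    conn u A t X = fderiv ℝ A t X + chr u t X (A t) := by
  rw [conn, hu.nabla_fderiv_field ht hA, tang_add, hu.tang_fderiv ht, chr, conn]

theorem nabla_fderiv_eq (hu : IsLagrangianOn u O) (ht : t ∈ O) {A : E3 → E3}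
    (hA : ContDiffOn ℝ ∞ A O) (X : E3) : nabla u (fun s => fderiv ℝ u s (A s)) t X =
      fderiv ℝ u t (fderiv ℝ A t X + chr u t X (A t)) + h u t X (A t) := by
  rw [hu.nabla_fderiv_field ht hA, nabla_fderiv_const, map_add, add_assoc]

theorem nabla_fderiv_comm (hu : IsLagrangianOn u O) (ht : t ∈ O) (X Y : E3) :
    nabla u (fun s => fderiv ℝ u s Y) t X = nabla u (fun s => fderiv ℝ u s X) t Y :=
  nabla_torsionFree ((hu.smooth.contDiffAt (hu.isOpen.mem_nhds ht)).of_le (by norm_cast)) X Y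

theorem chr_comm (hu : IsLagrangianOn u O) (ht : t ∈ O) (X Y : E3) :
    chr u t X Y = chr u t Y X := by
  simp only [chr, conn, hu.nabla_fderiv_comm ht X Y]

theorem h_comm (hu : IsLagrangianOn u O) (ht : t ∈ O) (X Y : E3) : h u t X Y = h u t Y X := by
  simp only [h, hu.nabla_fderiv_comm ht X Y]

theorem chr_add_right (hu : IsLagrangianOn u O) (ht : t ∈ O) (X Y Y' : E3) :
    chr u t X (Y + Y') = chr u t X Y + chr u t X Y' := by
  simp only [chr, conn, map_add]
  rw [hu.nabla_add (hu.isField_fderiv_const Y) (hu.isField_fderiv_const Y') ht, tang_add]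

theorem contDiffOn_chr (hu : IsLagrangianOn u O) (X Y : E3) :
    ContDiffOn ℝ ∞ (fun s => chr u s X Y) O :=
  hu.contDiffOn_tang (hu.isField_nabla (hu.isField_fderiv_const Y) X)

theorem isField_h (hu : IsLagrangianOn u O) (X Y : E3) : IsFieldOn u O (fun s => h u s X Y) :=
  hu.isField_nor (hu.isField_nabla (hu.isField_fderiv_const Y) X)

theorem isNormal_h (hu : IsLagrangianOn u O) (ht : t ∈ O) (X Y : E3) : IsNormal u t (h u t X Y) :=
  hu.isNormal_nor ht ((hu.isField_nabla (hu.isField_fderiv_const Y) X).tangent t ht)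

/-! #### The cubic form -/

theorem cubic_swap_left (hu : IsLagrangianOn u O) (ht : t ∈ O) (X Y Z : E3) :
    cubic u t X Y Z = cubic u t Y X Z := by rw [cubic, cubic, hu.h_comm ht]

theorem fderiv_of_eqOn_const (hu : IsLagrangianOn u O) (ht : t ∈ O) {f : E3 → ℝ} {c : ℝ}
    (hf : ∀ s ∈ O, f s = c) (X : E3) : fderiv ℝ f t X = 0 := by
  have : f =ᶠ[nhds t] fun _ => c := (hu.eventually_mem ht).mono hf
  rw [this.fderiv_eq]; simp

/-- This is the derivative of g(Y, JZ) = 0 in the direction X; the G term appears because J is not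
parallel. -/
theorem cubic_sub_swap (hu : IsLagrangianOn u O) (ht : t ∈ O) (X Y Z : E3) :
    cubic u t X Y Z - cubic u t X Z Y +
      g (u t) (fderiv ℝ u t Y) (G (u t) (fderiv ℝ u t X) (fderiv ℝ u t Z)) = 0 := by
  have hY := hu.isField_fderiv_const Y
  have hZ := hu.isField_fderiv_const Z
  have h1 := hu.fderiv_of_eqOn_const ht
    (f := fun s => g (u s) (fderiv ℝ u s Y) (J (u s) (fderiv ℝ u s Z)))
    (fun s hs => by rw [g_comm]; exact hu.g_J_fderiv hs Z Y) X
  rw [hu.fderiv_g hY (hu.isField_J hZ) ht, hu.nabla_J hZ ht, nabla_fderiv_const,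
    nabla_fderiv_const, g_add_left, g_fderiv_normal (hu.isNormal_J ht Z), J_add, g_add_right,
    g_add_right, g_fderiv_normal (hu.isNormal_J ht _), g_comm _ (fderiv ℝ u t Y) (J _ (h _ _ _ _)),
    g_J_left (hu.onS t ht)] at h1
  rw [cubic, cubic]
  linarith

/-- The form σ(X, Y, Z) = g(Y, G(X, Z)) is totally skew, while C is symmetric in its first two
arguments. Summing `cubic_sub_swap` cyclically therefore cancels all values of C and leaves 3σ = 0.
-/
theorem isNormal_G (hu : IsLagrangianOn u O) (ht : t ∈ O) (X Y : E3) :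
    IsNormal u t (G (u t) (fderiv ℝ u t X) (fderiv ℝ u t Y)) := by
  have hS := hu.onS t ht
  have hd := hu.fderiv_onS ht
  refine ⟨isTangent_G hS (hd X) (hd Y), fun Z => ?_⟩
  let σ : E3 → E3 → E3 → ℝ := fun X Y Z =>
    g (u t) (fderiv ℝ u t Y) (G (u t) (fderiv ℝ u t X) (fderiv ℝ u t Z))
  have s1 : ∀ X Y Z, σ X Y Z = -σ X Z Y := fun X Y Z => by
    simp only [σ]
    rw [g_comm, g_G_left hS (hd X) (hd Z) (hd Y)]
  have s2 : ∀ X Y Z, σ X Y Z = -σ Z Y X := fun X Y Z => by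
    simp only [σ]
    rw [G_antisymm hS (hd X) (hd Z), g_neg_right]
  have c1 := fun X Y Z => hu.cubic_sub_swap ht X Y Z
  have c2 := fun X Y Z => hu.cubic_swap_left ht X Y Z
  have c1' : ∀ X Y Z, cubic u t X Y Z - cubic u t X Z Y + σ X Y Z = 0 := c1
  have e : g (u t) (G (u t) (fderiv ℝ u t X) (fderiv ℝ u t Y)) (fderiv ℝ u t Z) = σ X Z Y :=
    g_comm _ _ _
  rw [e]
  linarith [c1' X Y Z, c1' Y Z X, c1' Z X Y, c2 X Y Z, c2 Y Z X, c2 Z X Y, s1 X Y Z, s1 Y Z X,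
    s1 Z X Y, s2 X Y Z, s2 Y Z X, s2 Z X Y]

theorem cubic_swap_right (hu : IsLagrangianOn u O) (ht : t ∈ O) (X Y Z : E3) :
    cubic u t X Y Z = cubic u t X Z Y := by
  have := hu.cubic_sub_swap ht X Y Z
  rw [g_fderiv_normal (hu.isNormal_G ht X Z)] at this
  linarith

theorem cubic_add_right (X Y Z Z' : E3) :
    cubic u t X Y (Z + Z') = cubic u t X Y Z + cubic u t X Y Z' := by
  simp only [cubic, map_add, J_add, g_add_right]

theorem contDiffOn_cubic (hu : IsLagrangianOn u O) (X Y Z : E3) :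
    ContDiffOn ℝ ∞ (fun s => cubic u s X Y Z) O :=
  hu.contDiffOn_g (hu.isField_h X Y) (hu.isField_J (hu.isField_fderiv_const Z))

/-- Minimality, in the form in which it is used. -/
theorem g_h_G_cyclic (hu : IsLagrangianOn u O) (ht : t ∈ O) (W X Y Z : E3) :
    g (u t) (h u t W X) (G (u t) (fderiv ℝ u t Y) (fderiv ℝ u t Z))
      + g (u t) (h u t W Y) (G (u t) (fderiv ℝ u t Z) (fderiv ℝ u t X))
      + g (u t) (h u t W Z) (G (u t) (fderiv ℝ u t X) (fderiv ℝ u t Y)) = 0 := by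
  have hS := hu.onS t ht
  have hd := hu.fderiv_onS ht
  have hh := fun X Y => (hu.isNormal_h ht X Y).tangent
  have hX := hu.isField_fderiv_const X
  have hY := hu.isField_fderiv_const Y
  have hZ := hu.isField_fderiv_const Z
  -- The relation g(Z, G(X, Y)) = 0 is differentiated along W. The derivative of G contributes only
  -- JX and JY, orthogonal to Z, and a multiple g(JX, Y) = 0 of W; what survives comes from the
  -- normal parts h(W, ·).
  have h1 := hu.fderiv_of_eqOn_const ht
    (f := fun s => g (u s) (fderiv ℝ u s Z) (G (u s) (fderiv ℝ u s X) (fderiv ℝ u s Y)))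
    (fun s hs => g_fderiv_normal (hu.isNormal_G hs X Y) Z) W
  rw [hu.fderiv_g hZ (hu.isField_G hX hY) ht, hu.nabla_G hX hY ht, nabla_fderiv_const,
    nabla_fderiv_const, nabla_fderiv_const, G_add_left hS (hd _) (hh _ _) (hd _),
    G_add_right hS (hd _) (hd _) (hh _ _), hu.g_J_fderiv ht] at h1
  simp only [g_add_left, g_add_right, g_smul_right, g_sub_right,
    g_fderiv_normal (hu.isNormal_G ht _ _), g_fderiv_normal (hu.isNormal_J ht _)] at h1
  have e1 : g (u t) (fderiv ℝ u t Z) (G (u t) (h u t W X) (fderiv ℝ u t Y)) =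
      g (u t) (h u t W X) (G (u t) (fderiv ℝ u t Y) (fderiv ℝ u t Z)) := by
    rw [G_antisymm hS (hh _ _) (hd _), g_neg_right, g_comm, g_G_left hS (hd _) (hh _ _) (hd _),
      neg_neg]
  have e2 : g (u t) (fderiv ℝ u t Z) (G (u t) (fderiv ℝ u t X) (h u t W Y)) =
      g (u t) (h u t W Y) (G (u t) (fderiv ℝ u t Z) (fderiv ℝ u t X)) := by
    rw [g_comm, g_G_left hS (hd _) (hh _ _) (hd _), G_antisymm hS (hd Z) (hd X), g_neg_right]
  rw [e1, e2] at h1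
  linarith

end IsLagrangianOn

namespace IsLagrangianOn

variable {u : E3 → HH} {O : Set E3} {t : E3}

/-! ### The covariant derivative of the cubic form -/

/-- The contribution g(h, Jh) vanishes because J maps normal vectors to tangent ones. The last
argument may vary so that Christoffel fields can be inserted in it. -/
theorem fderiv_g_h_fderiv (hu : IsLagrangianOn u O) (ht : t ∈ O) (X Y Z : E3) {A : E3 → E3}
    (hA : ContDiffOn ℝ ∞ A O) :
    fderiv ℝ (fun s => cubic u s Y Z (A s)) t X =
      g (u t) (nabla u (fun s => h u s Y Z) t X) (J (u t) (fderiv ℝ u t (A t)))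
      + cubic u t Y Z (fderiv ℝ A t X) + cubic u t Y Z (chr u t X (A t))
      + g (u t) (h u t Y Z) (G (u t) (fderiv ℝ u t X) (fderiv ℝ u t (A t))) := by
  have hd := hu.isField_fderiv hA
  have hN := hu.isNormal_h ht
  simp only [cubic]
  rw [hu.fderiv_g (hu.isField_h Y Z) (hu.isField_J hd) ht, hu.nabla_J hd ht,
    hu.nabla_fderiv_eq ht hA, map_add]
  simp only [J_add, g_add_right]
  rw [hu.g_normal_J_normal ht (hN _ _) (hN _ _)]
  ring

theorem fderiv_cubic_field (hu : IsLagrangianOn u O) (ht : t ∈ O) (X Y Z : E3) {A : E3 → E3}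
    (hA : ContDiffOn ℝ ∞ A O) :
    fderiv ℝ (fun s => cubic u s Y Z (A s)) t X =
      fderiv ℝ (fun s => cubic u s Y Z (A t)) t X + cubic u t Y Z (fderiv ℝ A t X) := by
  have h1 := hu.fderiv_g_h_fderiv ht X Y Z (contDiffOn_const (c := A t))
  simp only [fderiv_fun_const, Pi.zero_apply, _root_.zero_apply] at h1
  have h0 : cubic u t Y Z 0 = 0 := by
    have := cubic_add_right (u := u) (t := t) Y Z 0 0
    rw [add_zero] at this
    linarith
  rw [hu.fderiv_g_h_fderiv ht X Y Z hA, h1, h0]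
  ring

/-- The G term is the derivative of the factor J in g(h(Y, Z), JW). -/
theorem covCubic_eq (hu : IsLagrangianOn u O) (ht : t ∈ O) (X Y Z W : E3) :
    covCubic u t X Y Z W = g (u t) (nablaH u t X Y Z) (J (u t) (fderiv ℝ u t W))
      + g (u t) (h u t Y Z) (G (u t) (fderiv ℝ u t X) (fderiv ℝ u t W)) := by
  have h1 := hu.fderiv_g_h_fderiv ht X Y Z (contDiffOn_const (c := W))
  have h0 : cubic u t Y Z 0 = 0 := by
    have := cubic_add_right (u := u) (t := t) Y Z 0 0
    rw [add_zero] at this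
    linarith
  simp only [fderiv_fun_const, Pi.zero_apply, _root_.zero_apply, h0] at h1
  rw [covCubic, h1, nablaH, g_sub_left, g_sub_left, normalConn, g_nor_normal _ (hu.isNormal_J ht W)]
  simp only [cubic, chr]
  ring

theorem fderiv_congr_on (hu : IsLagrangianOn u O) (ht : t ∈ O) {f f' : E3 → ℝ}
    (hf : ∀ s ∈ O, f s = f' s) : fderiv ℝ f t = fderiv ℝ f' t :=
  Filter.EventuallyEq.fderiv_eq ((hu.eventually_mem ht).mono hf)

theorem covCubic_swap_left (hu : IsLagrangianOn u O) (ht : t ∈ O) (X Y Z W : E3) :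
    covCubic u t X Y Z W = covCubic u t X Z Y W := by
  rw [covCubic, covCubic, hu.fderiv_congr_on ht fun s hs => hu.cubic_swap_left hs Y Z W,
    hu.cubic_swap_left ht (chr u t X Y), hu.cubic_swap_left ht Y, hu.cubic_swap_left ht Y Z]
  ring

theorem covCubic_swap_right (hu : IsLagrangianOn u O) (ht : t ∈ O) (X Y Z W : E3) :
    covCubic u t X Y Z W = covCubic u t X Y W Z := by
  rw [covCubic, covCubic, hu.fderiv_congr_on ht fun s hs => hu.cubic_swap_right hs Y Z W,
    hu.cubic_swap_right ht (chr u t X Y), hu.cubic_swap_right ht Y, hu.cubic_swap_right ht Y Z]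
  ring

theorem covCubic_add_right (hu : IsLagrangianOn u O) (ht : t ∈ O) (X Y Z W W' : E3) :
    covCubic u t X Y Z (W + W') = covCubic u t X Y Z W + covCubic u t X Y Z W' := by
  simp only [covCubic, hu.chr_add_right ht, cubic_add_right]
  rw [fderiv_fun_add (differentiableAt_of_contDiffOn hu.isOpen (hu.contDiffOn_cubic Y Z W) ht)
    (differentiableAt_of_contDiffOn hu.isOpen (hu.contDiffOn_cubic Y Z W') ht),
    _root_.add_apply]
  ring

theorem cubic_add_left (hu : IsLagrangianOn u O) (ht : t ∈ O) (X X' Y Z : E3) :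
    cubic u t (X + X') Y Z = cubic u t X Y Z + cubic u t X' Y Z := by
  rw [hu.cubic_swap_left ht, hu.cubic_swap_right ht, cubic_add_right, hu.cubic_swap_right ht,
    hu.cubic_swap_left ht, hu.cubic_swap_right ht Y, hu.cubic_swap_left ht Y]

theorem cubic_add_mid (hu : IsLagrangianOn u O) (ht : t ∈ O) (X Y Y' Z : E3) :
    cubic u t X (Y + Y') Z = cubic u t X Y Z + cubic u t X Y' Z := by
  rw [hu.cubic_swap_left ht, hu.cubic_add_left ht, hu.cubic_swap_left ht Y,
    hu.cubic_swap_left ht Y']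

theorem covCubic_add_left (hu : IsLagrangianOn u O) (ht : t ∈ O) (X X' Y Z W : E3) :
    covCubic u t (X + X') Y Z W = covCubic u t X Y Z W + covCubic u t X' Y Z W := by
  have hc : ∀ A, chr u t (X + X') A = chr u t X A + chr u t X' A := fun A => by
    rw [hu.chr_comm ht, hu.chr_add_right ht, hu.chr_comm ht, hu.chr_comm ht A]
  simp only [covCubic, hc, map_add, cubic_add_right, hu.cubic_add_left ht, hu.cubic_add_mid ht]
  ring

theorem contDiffOn_covCubic (hu : IsLagrangianOn u O) (X Y Z W : E3) :
    ContDiffOn ℝ ∞ (fun s => covCubic u s X Y Z W) O := by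
  have hc : ∀ A B C : E3, ∀ V : E3, ContDiffOn ℝ ∞ (fun s => cubic u s A B (chr u s C V)) O :=
    fun A B C V => hu.contDiffOn_g (hu.isField_h A B)
      (hu.isField_J (hu.isField_fderiv (hu.contDiffOn_chr C V)))
  -- Total symmetry of C moves each Christoffel field to the last slot, so that h is only evaluated
  -- on constant coordinate vectors.
  have h1 : ContDiffOn ℝ ∞ (fun s => fderiv ℝ (fun s => cubic u s Y Z W) s X
      - cubic u s Z W (chr u s X Y) - cubic u s Y W (chr u s X Z) - cubic u s Y Z (chr u s X W)) O :=
    (((contDiffOn_fderiv_apply hu.isOpen (hu.contDiffOn_cubic Y Z W) contDiffOn_const).sub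
      (hc _ _ _ _)).sub (hc _ _ _ _)).sub (hc _ _ _ _)
  refine h1.congr fun s hs => ?_
  rw [covCubic, hu.cubic_swap_left hs (chr u s X Y), hu.cubic_swap_right hs Z,
    hu.cubic_swap_right hs Y (chr u s X Z)]

/-! ### The Ricci identity for the cubic form -/

/-- The curvature tensor in terms of Christoffel symbols. -/
theorem curv_eq (hu : IsLagrangianOn u O) (ht : t ∈ O) (X Y Z : E3) :
    curv u t X Y Z + (fderiv ℝ (fun s => chr u s X Z) t Y + chr u t Y (chr u t X Z)) =
      fderiv ℝ (fun s => chr u s Y Z) t X + chr u t X (chr u t Y Z) := by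
  have h1 := hu.conn_eq ht (hu.contDiffOn_chr Y Z) X
  have h2 := hu.conn_eq ht (hu.contDiffOn_chr X Z) Y
  rw [← h1, ← h2, curv]
  exact sub_add_cancel _ _

theorem cubic_curv (hu : IsLagrangianOn u O) (ht : t ∈ O) (X Y Z A B : E3) :
    cubic u t A B (curv u t X Y Z) =
      cubic u t A B (fderiv ℝ (fun s => chr u s Y Z) t X) + cubic u t A B (chr u t X (chr u t Y Z))
      - cubic u t A B (fderiv ℝ (fun s => chr u s X Z) t Y)
      - cubic u t A B (chr u t Y (chr u t X Z)) := by
  have := congrArg (cubic u t A B) (hu.curv_eq ht X Y Z)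
  simp only [cubic_add_right] at this
  linarith

theorem fderiv_fderiv_comm (hu : IsLagrangianOn u O) (ht : t ∈ O) {f : E3 → ℝ}
    (hf : ContDiffOn ℝ ∞ f O) (X Y : E3) :
    fderiv ℝ (fun s => fderiv ℝ f s Y) t X = fderiv ℝ (fun s => fderiv ℝ f s X) t Y := by
  have hc := hf.contDiffAt (hu.isOpen.mem_nhds ht)
  have hd : DifferentiableAt ℝ (fderiv ℝ f) t :=
    (hc.fderiv_right (m := 1) (by norm_cast)).differentiableAt (by norm_num)
  rw [fderiv_clm_apply hd (differentiableAt_const _), fderiv_clm_apply hd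
    (differentiableAt_const _)]
  simpa using (hc.isSymmSndFDerivAt (by simp; norm_cast)) X Y

/-- Each derivative of a term containing a Christoffel field is split into two parts. With the field
frozen at t it is part of a value of `covCubic`; the derivative of the field itself goes into the
curvature. -/
theorem fderiv_covCubic (hu : IsLagrangianOn u O) (ht : t ∈ O) (X Y Z W V : E3) :
    fderiv ℝ (fun s => covCubic u s Y Z W V) t X =
      fderiv ℝ (fun s => fderiv ℝ (fun s => cubic u s Z W V) s Y) t X
      - (fderiv ℝ (fun s => cubic u s W V (chr u t Y Z)) t X
        + cubic u t W V (fderiv ℝ (fun s => chr u s Y Z) t X))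
      - (fderiv ℝ (fun s => cubic u s Z V (chr u t Y W)) t X
        + cubic u t Z V (fderiv ℝ (fun s => chr u s Y W) t X))
      - (fderiv ℝ (fun s => cubic u s Z W (chr u t Y V)) t X
        + cubic u t Z W (fderiv ℝ (fun s => chr u s Y V) t X)) := by
  have hd : ∀ A B C V : E3, DifferentiableAt ℝ (fun s => cubic u s A B (chr u s C V)) t :=
    fun A B C V => differentiableAt_of_contDiffOn hu.isOpen (hu.contDiffOn_g (hu.isField_h A B)
      (hu.isField_J (hu.isField_fderiv (hu.contDiffOn_chr C V)))) ht
  have hd' : DifferentiableAt ℝ (fun s => fderiv ℝ (fun s => cubic u s Z W V) s Y) t :=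
    differentiableAt_of_contDiffOn hu.isOpen
      (contDiffOn_fderiv_apply hu.isOpen (hu.contDiffOn_cubic Z W V) contDiffOn_const) ht
  rw [hu.fderiv_congr_on ht (f' := fun s => fderiv ℝ (fun s => cubic u s Z W V) s Y
      - cubic u s W V (chr u s Y Z) - cubic u s Z V (chr u s Y W) - cubic u s Z W (chr u s Y V))
      fun s hs => ?_]
  · rw [fderiv_fun_sub ((hd'.fun_sub (hd _ _ _ _)).fun_sub (hd _ _ _ _)) (hd _ _ _ _),
      fderiv_fun_sub (hd'.fun_sub (hd _ _ _ _)) (hd _ _ _ _), fderiv_fun_sub hd' (hd _ _ _ _)]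
    simp only [_root_.sub_apply]
    rw [hu.fderiv_cubic_field ht X W V (hu.contDiffOn_chr Y Z),
      hu.fderiv_cubic_field ht X Z V (hu.contDiffOn_chr Y W),
      hu.fderiv_cubic_field ht X Z W (hu.contDiffOn_chr Y V)]
  · rw [covCubic, hu.cubic_swap_left hs (chr u s Y Z), hu.cubic_swap_right hs W,
      hu.cubic_swap_right hs Z (chr u s Y W)]

/-- The Ricci identity for the cubic form. -/
theorem fderiv_covCubic_sub (hu : IsLagrangianOn u O) (ht : t ∈ O) (X Y Z W V : E3) :
    fderiv ℝ (fun s => covCubic u s Y Z W V) t X - fderiv ℝ (fun s => covCubic u s X Z W V) t Y =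
      -(covCubic u t X (chr u t Y Z) W V - covCubic u t Y (chr u t X Z) W V
        + cubic u t W V (curv u t X Y Z))
      - (covCubic u t X Z (chr u t Y W) V - covCubic u t Y Z (chr u t X W) V
        + cubic u t Z V (curv u t X Y W))
      - (covCubic u t X Z W (chr u t Y V) - covCubic u t Y Z W (chr u t X V)
        + cubic u t Z W (curv u t X Y V)) := by
  rw [hu.fderiv_covCubic ht X Y, hu.fderiv_covCubic ht Y X,
    hu.fderiv_fderiv_comm ht (hu.contDiffOn_cubic Z W V) X Y,
    hu.covCubic_swap_left ht _ (chr u t Y Z), hu.covCubic_swap_right ht _ W (chr u t Y Z),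
    hu.covCubic_swap_left ht _ (chr u t X Z), hu.covCubic_swap_right ht _ W (chr u t X Z),
    hu.covCubic_swap_right ht _ Z (chr u t Y W), hu.covCubic_swap_right ht _ Z (chr u t X W)]
  simp only [hu.cubic_curv ht, covCubic]
  have s := hu.cubic_swap_left ht
  have r := hu.cubic_swap_right ht
  -- Only terms with two Christoffel vectors in different slots of C remain, and they cancel by its
  -- symmetry.
  linarith [s (chr u t X W) V (chr u t Y Z), r V (chr u t X W) (chr u t Y Z),
    r V (chr u t Y Z) (chr u t X W), s (chr u t Y W) V (chr u t X Z),
    r V (chr u t Y W) (chr u t X Z), s (chr u t X Z) V (chr u t Y W),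
    r W (chr u t X V) (chr u t Y Z), r W (chr u t Y V) (chr u t X Z),
    s (chr u t X Z) W (chr u t Y V), s (chr u t Y Z) W (chr u t X V),
    s (chr u t X Z) V (chr u t Y W), s (chr u t Y Z) V (chr u t X W),
    r Z (chr u t X V) (chr u t Y W), r Z (chr u t Y V) (chr u t X W),
    s Z (chr u t X V) (chr u t Y W), s Z (chr u t Y V) (chr u t X W),
    s (chr u t X Z) W (chr u t Y V), s (chr u t Y Z) W (chr u t X V)]

/-! ### The Ricci equation -/

theorem g_normalConn_h (hu : IsLagrangianOn u O) (ht : t ∈ O) (X Y Z V : E3) :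
    g (u t) (normalConn u (fun s => h u s Y Z) t X) (J (u t) (fderiv ℝ u t V)) =
      fderiv ℝ (fun s => cubic u s Y Z V) t X - cubic u t Y Z (chr u t X V)
      - g (u t) (h u t Y Z) (G (u t) (fderiv ℝ u t X) (fderiv ℝ u t V)) := by
  have h1 := hu.fderiv_g_h_fderiv ht X Y Z (contDiffOn_const (c := V))
  have h0 : cubic u t Y Z 0 = 0 := by
    have := cubic_add_right (u := u) (t := t) Y Z 0 0
    rw [add_zero] at this
    linarith
  simp only [fderiv_fun_const, Pi.zero_apply, _root_.zero_apply, h0] at h1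
  rw [normalConn, g_nor_normal _ (hu.isNormal_J ht V)]
  linarith

/-- For N = JA and N' = JB, the relation GJ = -JG and the J-invariance of g reduce the value to
-g(A, G(V, B)), which is zero since G(V, B) is normal. -/
theorem g_h_G_tangent_normal (hu : IsLagrangianOn u O) (ht : t ∈ O) {N N' : HH} (V : E3)
    (hN : IsNormal u t N) (hN' : IsNormal u t N') :
    g (u t) N (G (u t) (fderiv ℝ u t V) N') = 0 := by
  have hS := hu.onS t ht
  obtain ⟨A, rfl⟩ := hN.exists_eq hu ht
  obtain ⟨B, rfl⟩ := hN'.exists_eq hu ht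
  rw [G_J hS (hu.fderiv_onS ht V) (hu.fderiv_onS ht B), g_neg_right, g_J_J hS,
    g_fderiv_normal (hu.isNormal_G ht V B), neg_zero]

theorem fderiv_g_h_G (hu : IsLagrangianOn u O) (ht : t ∈ O) (X Y V Z W : E3) :
    fderiv ℝ (fun s => g (u s) (h u s Z W) (G (u s) (fderiv ℝ u s Y) (fderiv ℝ u s V))) t X =
      g (u t) (normalConn u (fun s => h u s Z W) t X)
        (G (u t) (fderiv ℝ u t Y) (fderiv ℝ u t V))
      + g (u t) (h u t Z W) (G (u t) (fderiv ℝ u t (chr u t X Y)) (fderiv ℝ u t V))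
      + g (u t) (h u t Z W) (G (u t) (fderiv ℝ u t Y) (fderiv ℝ u t (chr u t X V)))
      + 1 / 3 * (g (u t) (fderiv ℝ u t X) (fderiv ℝ u t V) * cubic u t Z W Y
        - g (u t) (fderiv ℝ u t X) (fderiv ℝ u t Y) * cubic u t Z W V) := by
  have hS := hu.onS t ht
  have hd := hu.fderiv_onS ht
  have hh := fun X Y => hu.isNormal_h ht X Y
  have hY := hu.isField_fderiv_const Y
  have hV := hu.isField_fderiv_const V
  rw [hu.fderiv_g (hu.isField_h Z W) (hu.isField_G hY hV) ht, hu.nabla_G hY hV ht,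
    nabla_fderiv_const, nabla_fderiv_const, G_add_left hS (hd _) (hh _ _).tangent (hd _),
    G_add_right hS (hd _) (hd _) (hh _ _).tangent, hu.g_J_fderiv ht, normalConn,
    g_nor_normal _ (hu.isNormal_G ht Y V),
    G_antisymm hS (hh X Y).tangent (hd V)]
  simp only [g_add_right, g_smul_right, g_sub_right, g_neg_right,
    hu.g_h_G_tangent_normal ht _ (hh _ _) (hh _ _), (hh Z W).g_eq_zero, cubic]
  ring

/-- The Ricci equation for `h(Z, W)`, paired with `J V`. -/
theorem g_normalCurv_h (hu : IsLagrangianOn u O) (ht : t ∈ O) (X Y Z W V : E3) :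
    g (u t) (normalCurv u (fun s => h u s Z W) t X Y) (J (u t) (fderiv ℝ u t V)) =
      -cubic u t Z W (curv u t X Y V)
      - 1 / 3 * (g (u t) (fderiv ℝ u t X) (fderiv ℝ u t V) * cubic u t Z W Y
        - g (u t) (fderiv ℝ u t Y) (fderiv ℝ u t V) * cubic u t Z W X) := by
  have hS := hu.onS t ht
  have hV := hu.isField_fderiv_const V
  -- The derivative of g(∇^⊥ξ, JV), with ξ = h(Z, W), is taken using that the normal part of the
  -- derivative of JV is J∇V + G(·, V). After skew-symmetrization in X and Y, R acts on V, and the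
  -- derivative of G leaves the terms with factor 1/3.
  have key : ∀ X Y : E3,
      g (u t) (normalConn u (fun s => normalConn u (fun s => h u s Z W) s Y) t X)
        (J (u t) (fderiv ℝ u t V)) =
      fderiv ℝ (fun s => fderiv ℝ (fun s => cubic u s Z W V) s Y) t X
        - (fderiv ℝ (fun s => cubic u s Z W (chr u t Y V)) t X
          + cubic u t Z W (fderiv ℝ (fun s => chr u s Y V) t X))
        - (g (u t) (normalConn u (fun s => h u s Z W) t X)
            (G (u t) (fderiv ℝ u t Y) (fderiv ℝ u t V))
          + g (u t) (h u t Z W) (G (u t) (fderiv ℝ u t (chr u t X Y)) (fderiv ℝ u t V))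
          + g (u t) (h u t Z W) (G (u t) (fderiv ℝ u t Y) (fderiv ℝ u t (chr u t X V)))
          + 1 / 3 * (g (u t) (fderiv ℝ u t X) (fderiv ℝ u t V) * cubic u t Z W Y
            - g (u t) (fderiv ℝ u t X) (fderiv ℝ u t Y) * cubic u t Z W V))
        - (fderiv ℝ (fun s => cubic u s Z W (chr u t X V)) t Y
          - cubic u t Z W (chr u t Y (chr u t X V))
          - g (u t) (h u t Z W) (G (u t) (fderiv ℝ u t Y) (fderiv ℝ u t (chr u t X V))))
        - g (u t) (normalConn u (fun s => h u s Z W) t Y)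
            (G (u t) (fderiv ℝ u t X) (fderiv ℝ u t V)) := by
    intro X Y
    have hξ : IsFieldOn u O (fun s => normalConn u (fun s => h u s Z W) s Y) :=
      hu.isField_nor (hu.isField_nabla (hu.isField_h Z W) Y)
    have hξN : IsNormal u t (normalConn u (fun s => h u s Z W) t Y) :=
      hu.isNormal_nor ht ((hu.isField_nabla (hu.isField_h Z W) Y).tangent t ht)
    have h1 := hu.fderiv_g hξ (hu.isField_J hV) ht X
    rw [hu.nabla_J hV ht, nabla_fderiv_const, J_add, g_add_right, g_add_right,
      hu.g_normal_J_normal ht hξN (hu.isNormal_h ht X V), hu.g_normalConn_h ht Y Z W,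
      hu.fderiv_congr_on ht fun s hs => hu.g_normalConn_h hs Y Z W V] at h1
    have d1 : DifferentiableAt ℝ (fun s => fderiv ℝ (fun s => cubic u s Z W V) s Y) t :=
      differentiableAt_of_contDiffOn hu.isOpen
        (contDiffOn_fderiv_apply hu.isOpen (hu.contDiffOn_cubic Z W V) contDiffOn_const) ht
    have d2 : DifferentiableAt ℝ (fun s => cubic u s Z W (chr u s Y V)) t :=
      differentiableAt_of_contDiffOn hu.isOpen (hu.contDiffOn_g (hu.isField_h Z W)
        (hu.isField_J (hu.isField_fderiv (hu.contDiffOn_chr Y V)))) ht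
    have d3 : DifferentiableAt ℝ
        (fun s => g (u s) (h u s Z W) (G (u s) (fderiv ℝ u s Y) (fderiv ℝ u s V))) t :=
      differentiableAt_of_contDiffOn hu.isOpen (hu.contDiffOn_g (hu.isField_h Z W)
        (hu.isField_G (hu.isField_fderiv_const Y) hV)) ht
    rw [fderiv_fun_sub (d1.fun_sub d2) d3, fderiv_fun_sub d1 d2] at h1
    simp only [_root_.sub_apply] at h1
    rw [hu.fderiv_g_h_G ht, hu.fderiv_cubic_field ht X Z W (hu.contDiffOn_chr Y V)] at h1
    rw [normalConn, g_nor_normal _ (hu.isNormal_J ht V)]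
    linarith
  rw [normalCurv, g_sub_left, key X Y, key Y X,
    hu.fderiv_fderiv_comm ht (hu.contDiffOn_cubic Z W V) X Y, hu.chr_comm ht Y X,
    hu.cubic_curv ht, g_comm _ (fderiv ℝ u t Y) (fderiv ℝ u t X)]
  ring

/-! ### The Codazzi equation in terms of the cubic form -/

/-- The Codazzi equation. -/
theorem codazzi (hu : IsLagrangianOn u O) (ht : t ∈ O) (X Y Z : E3) {N : HH}
    (hN : IsNormal u t N) : g (u t) (nablaH u t X Y Z) N - g (u t) (nablaH u t Y X Z) N =
      g (u t) (curvS (u t) (fderiv ℝ u t X) (fderiv ℝ u t Y) (fderiv ℝ u t Z)) N := by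
  have hZ := hu.isField_fderiv_const Z
  -- The equation is the normal part of the ambient Ricci identity for the tangent field Z, split by
  -- the Gauss formula.
  have key : ∀ X Y : E3,
      g (u t) (nabla u (fun s => nabla u (fun s => fderiv ℝ u s Z) s Y) t X) N =
        g (u t) (h u t X (chr u t Y Z)) N + g (u t) (nabla u (fun s => h u s Y Z) t X) N := by
    intro X Y
    have hc := hu.contDiffOn_chr Y Z
    rw [hu.nabla_congr (ξ := fun s => nabla u (fun s => fderiv ℝ u s Z) s Y)
      (η := fun s => fderiv ℝ u s (chr u s Y Z) + h u s Y Z) ht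
      (fun s _ => nabla_fderiv_const Y Z), hu.nabla_add (hu.isField_fderiv hc) (hu.isField_h Y Z) ht,
      hu.nabla_fderiv_eq ht hc, g_add_left, g_add_left, g_fderiv_normal hN, zero_add]
  rw [← hu.nabla_nabla_sub hZ ht, g_sub_left, key X Y, key Y X]
  simp only [nablaH, normalConn, g_sub_left, g_nor_normal _ hN]
  change _ - g _ (h u t (chr u t X Y) Z) N - g _ (h u t Y (chr u t X Z)) N -
    (_ - g _ (h u t (chr u t Y X) Z) N - g _ (h u t X (chr u t Y Z)) N) = _
  rw [hu.chr_comm ht Y X]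
  ring

/-- Against a normal vector the 5/12 part of the curvature vanishes because it is tangent, and the
1/12 part because its coefficients are values g(J ·, ·) on tangent vectors. Only the P part remains.
-/
theorem g_curvS (hu : IsLagrangianOn u O) (ht : t ∈ O) (X Y Z : E3) {N : HH}
    (hN : IsNormal u t N) :
    3 * g (u t) (curvS (u t) (fderiv ℝ u t X) (fderiv ℝ u t Y) (fderiv ℝ u t Z)) N =
      g (u t) (P (u t) (fderiv ℝ u t Y)) (fderiv ℝ u t Z) * g (u t) (P (u t) (fderiv ℝ u t X)) N
      - g (u t) (P (u t) (fderiv ℝ u t X)) (fderiv ℝ u t Z) * g (u t) (P (u t) (fderiv ℝ u t Y)) N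
      + g (u t) (J (u t) (P (u t) (fderiv ℝ u t Y))) (fderiv ℝ u t Z) *
          g (u t) (J (u t) (P (u t) (fderiv ℝ u t X))) N
      - g (u t) (J (u t) (P (u t) (fderiv ℝ u t X))) (fderiv ℝ u t Z) *
          g (u t) (J (u t) (P (u t) (fderiv ℝ u t Y))) N := by
  simp only [curvS, hu.g_J_fderiv ht, g_add_left, g_sub_left, g_smul_left, g_fderiv_normal hN]
  ring

/-- This is Codazzi paired with JV: the relation JP = -PJ turns the curvature into products of the P
and PJ forms, and passing from ∇h to ∇C adds the g(h, G) terms. -/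
theorem covCubic_sub_swap (hu : IsLagrangianOn u O) (ht : t ∈ O) (Y Z W V : E3) :
    3 * (covCubic u t Y Z W V - covCubic u t Z Y W V) =
      g (u t) (P (u t) (fderiv ℝ u t Z)) (fderiv ℝ u t W) *
          g (u t) (PJ (u t) (fderiv ℝ u t Y)) (fderiv ℝ u t V)
      - g (u t) (P (u t) (fderiv ℝ u t Y)) (fderiv ℝ u t W) *
          g (u t) (PJ (u t) (fderiv ℝ u t Z)) (fderiv ℝ u t V)
      - g (u t) (PJ (u t) (fderiv ℝ u t Z)) (fderiv ℝ u t W) *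
          g (u t) (P (u t) (fderiv ℝ u t Y)) (fderiv ℝ u t V)
      + g (u t) (PJ (u t) (fderiv ℝ u t Y)) (fderiv ℝ u t W) *
          g (u t) (P (u t) (fderiv ℝ u t Z)) (fderiv ℝ u t V)
      + 3 * (g (u t) (h u t Z W) (G (u t) (fderiv ℝ u t Y) (fderiv ℝ u t V))
        - g (u t) (h u t Y W) (G (u t) (fderiv ℝ u t Z) (fderiv ℝ u t V))) := by
  have hS := hu.onS t ht
  have hN := hu.isNormal_J ht V
  have h1 := hu.codazzi ht Y Z W hN
  have h2 := hu.g_curvS ht Y Z W hN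
  have h3 : ∀ w v, g (u t) (P (u t) w) (J (u t) v) = g (u t) (PJ (u t) w) v := fun w v => by
    rw [PJ_eq hS, g_neg_left, g_J_left hS, neg_neg]
  have h4 : ∀ w, J (u t) (P (u t) w) = -PJ (u t) w := fun w => by rw [PJ_eq hS, neg_neg]
  rw [g_J_J hS, g_J_J hS, h3, h3, h4, h4, g_neg_left, g_neg_left] at h2
  rw [hu.covCubic_eq ht, hu.covCubic_eq ht]
  linarith

end IsLagrangianOn

/-! ### `J`-isotropic Lagrangian immersions -/

/-- A symmetric quartic form which vanishes on the diagonal is zero. -/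
theorem symm_quartic_eq_zero {E : Type*} [AddCommGroup E] {S : E → E → E → E → ℝ}
    (hadd : ∀ a b c d d', S a b c (d + d') = S a b c d + S a b c d')
    (h12 : ∀ a b c d, S a b c d = S b a c d) (h23 : ∀ a b c d, S a b c d = S a c b d)
    (h34 : ∀ a b c d, S a b c d = S a b d c) (h0 : ∀ v, S v v v v = 0) (a b c d : E) :
    S a b c d = 0 := by
  have add3 : ∀ a b c c' d, S a b (c + c') d = S a b c d + S a b c' d := fun a b c c' d => by
    rw [h34, hadd, h34 a b d c, h34 a b d c']
  have add2 : ∀ a b b' c d, S a (b + b') c d = S a b c d + S a b' c d := fun a b b' c d => by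
    rw [h23, add3, h23 a c b, h23 a c b']
  have add1 : ∀ a a' b c d, S (a + a') b c d = S a b c d + S a' b c d := fun a a' b c d => by
    rw [h12, add2, h12 b a, h12 b a']
  have neg4 : ∀ a b c d, S a b c (-d) = -S a b c d := fun a b c d => by
    have h1 := hadd a b c d (-d)
    have h2 := hadd a b c 0 0
    rw [add_zero] at h2
    rw [add_neg_cancel] at h1
    linarith
  -- The terms odd in b cancel between the values at a + b and a - b, leaving 12 S(a, a, b, b) = 0.
  -- Polarizing each repeated argument in turn then gives all values, using additivity alone.
  have q1 : ∀ a b, S a a b b = 0 := fun a b => by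
    have e1 := h0 (a + b)
    have e2 := h0 (a + -b)
    have neg3 : ∀ x y z w, S x y (-z) w = -S x y z w := fun x y z w => by
      rw [h34, neg4, h34]
    have neg2 : ∀ x y z w, S x (-y) z w = -S x y z w := fun x y z w => by
      rw [h23, neg3, h23]
    have neg1 : ∀ x y z w, S (-x) y z w = -S x y z w := fun x y z w => by
      rw [h12, neg2, h12]
    simp only [add1, add2, add3, hadd, neg1, neg2, neg3, neg4, h0] at e1 e2
    linarith [h23 a b a b, h12 b a a b, h34 a b a b, h34 b a b a, h12 b a b a, h23 b b a a,
      h23 a b b a, h34 b a a b, h12 a b b a, h23 b a b a]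
  have q2 : ∀ a b c, S a a b c = 0 := fun a b c => by
    have e := q1 a (b + c)
    simp only [add3, hadd, q1] at e
    linarith [h34 a a b c]
  have e := q2 (a + b) c d
  simp only [add1, add2, q2] at e
  linarith [h12 a b c d]

/-- The induced metric. -/
def metr (u : E3 → HH) (t X Y : E3) : ℝ := g (u t) (fderiv ℝ u t X) (fderiv ℝ u t Y)

/-- The restriction of `g(P ·, ·)` to the submanifold. -/
def formP (u : E3 → HH) (t X Y : E3) : ℝ :=
  g (u t) (P (u t) (fderiv ℝ u t X)) (fderiv ℝ u t Y)

/-- The restriction of `g(PJ ·, ·)` to the submanifold. -/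
def formPJ (u : E3 → HH) (t X Y : E3) : ℝ :=
  g (u t) (PJ (u t) (fderiv ℝ u t X)) (fderiv ℝ u t Y)

/-- The tensor `g(h(X, Y), G(Z, W))`. -/
def formHG (u : E3 → HH) (t X Y Z W : E3) : ℝ :=
  g (u t) (h u t X Y) (G (u t) (fderiv ℝ u t Z) (fderiv ℝ u t W))

/-- The immersion parametrized by `u` is `J`-isotropic with function `l`. -/
def IsJIsotropicOn (u : E3 → HH) (O : Set E3) (l : E3 → ℝ) : Prop :=
  ∀ s ∈ O, ∀ v, g (u s) (nablaH u s v v v) (J (u s) (fderiv ℝ u s v)) = l s * metr u s v v ^ 2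

theorem metr_comm (u : E3 → HH) (t X Y : E3) : metr u t X Y = metr u t Y X := g_comm _ _ _

namespace IsLagrangianOn

variable {u : E3 → HH} {O : Set E3} {t : E3} {l : E3 → ℝ}

theorem metr_add_right (X Y Y' : E3) : metr u t X (Y + Y') = metr u t X Y + metr u t X Y' := by
  simp only [metr, map_add, g_add_right]

theorem formP_comm (hu : IsLagrangianOn u O) (ht : t ∈ O) (X Y : E3) :
    formP u t X Y = formP u t Y X := by
  rw [formP, g_P_left (hu.onS t ht), g_comm]; rfl

theorem formPJ_comm (hu : IsLagrangianOn u O) (ht : t ∈ O) (X Y : E3) :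
    formPJ u t X Y = formPJ u t Y X := by
  have hS := hu.onS t ht
  rw [formPJ, PJ, g_P_left hS, g_J_left hS, ← g_neg_right, ← PJ_eq hS, g_comm]; rfl

theorem formHG_comm (hu : IsLagrangianOn u O) (ht : t ∈ O) (X Y Z W : E3) :
    formHG u t X Y Z W = formHG u t Y X Z W := by
  rw [formHG, hu.h_comm ht]; rfl

theorem formHG_antisymm (hu : IsLagrangianOn u O) (ht : t ∈ O) (X Y Z W : E3) :
    formHG u t X Y Z W = -formHG u t X Y W Z := by
  rw [formHG, G_antisymm (hu.onS t ht) (hu.fderiv_onS ht Z) (hu.fderiv_onS ht W), g_neg_right]; rfl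

/-- On the diagonal the correction g(h, G) drops out by skew-symmetry of G, so isotropy of ∇h
becomes a condition on ∇C. -/
theorem covCubic_diag (hu : IsLagrangianOn u O) (hl : IsJIsotropicOn u O l) (ht : t ∈ O) (v : E3) :
    covCubic u t v v v v = l t * metr u t v v ^ 2 := by
  rw [hu.covCubic_eq ht, hl t ht]
  have := hu.formHG_antisymm ht v v v v
  rw [formHG] at this
  linarith

/-- For a fixed nonzero coordinate vector v the function is the quotient of ∇C(v, v, v, v) by g(v,
v)², both smooth, with positive denominator. -/
theorem contDiffOn_of_isotropic (hu : IsLagrangianOn u O) (hl : IsJIsotropicOn u O l) :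
    ContDiffOn ℝ ∞ l O := by
  let v : E3 := coordVec 0
  have hv : v ≠ 0 := fun h => by
    have := congrArg (fun w : E3 => w 0) h
    simp [v, coordVec] at this
  have hpos : ∀ s ∈ O, metr u s v v ^ 2 ≠ 0 := fun s hs => by
    refine pow_ne_zero 2 (g_self_pos (hu.onS s hs) fun h => hv (hu.injective s hs ?_)).ne'
    rw [h, map_zero]
  have hm : ContDiffOn ℝ ∞ (fun s => metr u s v v ^ 2) O :=
    (hu.contDiffOn_g (hu.isField_fderiv_const v) (hu.isField_fderiv_const v)).pow 2
  refine ((hu.contDiffOn_covCubic v v v v).div hm hpos).congr fun s hs => ?_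
  rw [Pi.div_apply, eq_div_iff (hpos s hs), hu.covCubic_diag hl hs]

/-- The polarized form of `J`-isotropy. -/
theorem covCubic_symm (hu : IsLagrangianOn u O) (hl : IsJIsotropicOn u O l) (ht : t ∈ O)
    (X Y Z W : E3) :
    covCubic u t X Y Z W + covCubic u t Y X Z W + covCubic u t Z X Y W + covCubic u t W X Y Z =
      4 / 3 * l t * (metr u t X Y * metr u t Z W + metr u t X Z * metr u t Y W
        + metr u t X W * metr u t Y Z) := by
  have s := hu.covCubic_swap_left ht
  have r := hu.covCubic_swap_right ht
  have m := metr_comm u t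
  -- On the diagonal the four values of ∇C give 4λ and the three products of metrics are equal,
  -- whence the constant 4/3.
  have key := symm_quartic_eq_zero (S := fun X Y Z W =>
    covCubic u t X Y Z W + covCubic u t Y X Z W + covCubic u t Z X Y W + covCubic u t W X Y Z -
      4 / 3 * l t * (metr u t X Y * metr u t Z W + metr u t X Z * metr u t Y W
        + metr u t X W * metr u t Y Z))
    (fun a b c d d' => by
      simp only [hu.covCubic_add_right ht, hu.covCubic_add_left ht, metr_add_right]; ring)
    (fun a b c d => by rw [s c a b d, s d a b c, m a b]; ring)
    (fun a b c d => by rw [s a b c d, r d a b c, m b c]; ring)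
    (fun a b c d => by rw [r a b c d, r b a c d, m c d]; ring)
    (fun v => by simp only [hu.covCubic_diag hl ht]; ring) X Y Z W
  linarith

/-- The covariant derivative of the cubic form of a `J`-isotropic Lagrangian immersion. -/
theorem covCubic_explicit (hu : IsLagrangianOn u O) (hl : IsJIsotropicOn u O l) (ht : t ∈ O)
    (Y Z W V : E3) :
    12 * covCubic u t Y Z W V =
      4 * l t * (metr u t Y Z * metr u t W V + metr u t Y W * metr u t V Z
        + metr u t Y V * metr u t Z W)
      - 2 * (formP u t Y Z * formPJ u t W V + formP u t Y W * formPJ u t V Z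
        + formP u t Y V * formPJ u t Z W)
      + 2 * (formPJ u t Y Z * formP u t W V + formPJ u t Y W * formP u t V Z
        + formPJ u t Y V * formP u t Z W)
      + 9 * formHG u t Z W Y V - 3 * formHG u t Y Z W V - 3 * formHG u t Y W Z V := by
  have s := hu.covCubic_swap_left ht
  have r := hu.covCubic_swap_right ht
  have e0 := hu.covCubic_symm hl ht Y Z W V
  have e1 := hu.covCubic_sub_swap ht Y Z W V
  have e2 := hu.covCubic_sub_swap ht Y W Z V
  have e3 := hu.covCubic_sub_swap ht Y V Z W
  have e4 := hu.g_h_G_cyclic ht Z V Y W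
  change _ = formP u t Z W * formPJ u t Y V - formP u t Y W * formPJ u t Z V
    - formPJ u t Z W * formP u t Y V + formPJ u t Y W * formP u t Z V
    + 3 * (formHG u t Z W Y V - formHG u t Y W Z V) at e1
  change _ = formP u t W Z * formPJ u t Y V - formP u t Y Z * formPJ u t W V
    - formPJ u t W Z * formP u t Y V + formPJ u t Y Z * formP u t W V
    + 3 * (formHG u t W Z Y V - formHG u t Y Z W V) at e2
  change _ = formP u t V Z * formPJ u t Y W - formP u t Y Z * formPJ u t V W
    - formPJ u t V Z * formP u t Y W + formPJ u t Y Z * formP u t V W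
    + 3 * (formHG u t V Z Y W - formHG u t Y Z V W) at e3
  change formHG u t Z V Y W + formHG u t Z Y W V + formHG u t Z W V Y = 0 at e4
  rw [hu.formP_comm ht W Z, hu.formPJ_comm ht W Z, hu.formHG_comm ht W Z, s Y W Z V] at e2
  rw [hu.formP_comm ht V W, hu.formPJ_comm ht V W, hu.formHG_comm ht V Z,
    hu.formHG_antisymm ht Y Z V W, r Y V Z W, s Y V W Z, r Y W V Z, s Y W Z V] at e3
  rw [hu.formHG_comm ht Z Y, hu.formHG_antisymm ht Z W V Y] at e4
  rw [hu.formP_comm ht Z V, hu.formPJ_comm ht Z V] at e1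
  rw [metr_comm u t V Z]
  -- The sum in `e0` and the three exchanges of Y with Z, W, V isolate 12 times the value with Y
  -- first. The cyclic identity `e4` eliminates g(h(Z, V), G(Y, W)), which is why g(h(Z, W), G(Y,
  -- V)) acquires the coefficient 9 instead of 6.
  linear_combination 3 * e0 + e1 + e2 + e3 + 3 * e4

end IsLagrangianOn

/-! ### Differentiating the formula for the derivative of the cubic form -/

/-- The part of the derivative of `formP` that does not involve the induced connection. -/
def covFormP (u : E3 → HH) (t X Y Z : E3) : ℝ :=
  g (u t) (P (u t) (fderiv ℝ u t Y)) (h u t X Z)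
  + g (u t) (covDeriv P (u t) (fderiv ℝ u t X) (fderiv ℝ u t Y) + P (u t) (h u t X Y))
      (fderiv ℝ u t Z)

/-- The part of the derivative of `formPJ` that does not involve the induced connection. -/
def covFormPJ (u : E3 → HH) (t X Y Z : E3) : ℝ :=
  g (u t) (PJ (u t) (fderiv ℝ u t Y)) (h u t X Z)
  + g (u t) (covDeriv PJ (u t) (fderiv ℝ u t X) (fderiv ℝ u t Y) + PJ (u t) (h u t X Y))
      (fderiv ℝ u t Z)

/-- The part of the derivative of `formHG` that does not involve the induced connection. -/
def covFormHG (u : E3 → HH) (t X Y Z W V : E3) : ℝ :=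
  g (u t) (nablaH u t X Y Z) (G (u t) (fderiv ℝ u t W) (fderiv ℝ u t V))
  + 1 / 3 * (metr u t X V * cubic u t Y Z W - metr u t X W * cubic u t Y Z V)

namespace IsLagrangianOn

variable {u : E3 → HH} {O : Set E3} {t : E3} {l : E3 → ℝ}

theorem hasFDerivAt_of_contDiffOn (hu : IsLagrangianOn u O) (ht : t ∈ O) {f : E3 → ℝ}
    (hf : ContDiffOn ℝ ∞ f O) : HasFDerivAt f (fderiv ℝ f t) t :=
  (differentiableAt_of_contDiffOn hu.isOpen hf ht).hasFDerivAt

theorem contDiffOn_metr (hu : IsLagrangianOn u O) (X Y : E3) :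
    ContDiffOn ℝ ∞ (fun s => metr u s X Y) O :=
  hu.contDiffOn_g (hu.isField_fderiv_const X) (hu.isField_fderiv_const Y)

theorem contDiffOn_formP (hu : IsLagrangianOn u O) (X Y : E3) :
    ContDiffOn ℝ ∞ (fun s => formP u s X Y) O :=
  hu.contDiffOn_g (hu.isField_P (hu.isField_fderiv_const X)) (hu.isField_fderiv_const Y)

theorem contDiffOn_formPJ (hu : IsLagrangianOn u O) (X Y : E3) :
    ContDiffOn ℝ ∞ (fun s => formPJ u s X Y) O :=
  hu.contDiffOn_g (hu.isField_PJ (hu.isField_fderiv_const X)) (hu.isField_fderiv_const Y)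

theorem contDiffOn_formHG (hu : IsLagrangianOn u O) (X Y Z W : E3) :
    ContDiffOn ℝ ∞ (fun s => formHG u s X Y Z W) O :=
  hu.contDiffOn_g (hu.isField_h X Y)
    (hu.isField_G (hu.isField_fderiv_const Z) (hu.isField_fderiv_const W))

theorem fderiv_metr (hu : IsLagrangianOn u O) (ht : t ∈ O) (X Y Z : E3) :
    fderiv ℝ (fun s => metr u s Y Z) t X = metr u t (chr u t X Y) Z + metr u t Y (chr u t X Z) := by
  have hN := hu.isNormal_h ht
  simp only [metr]
  rw [hu.fderiv_g (hu.isField_fderiv_const Y) (hu.isField_fderiv_const Z) ht, nabla_fderiv_const,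
    nabla_fderiv_const, g_add_left, g_add_right, (hN X Y).g_eq_zero, g_fderiv_normal (hN X Z)]
  ring

theorem fderiv_formP (hu : IsLagrangianOn u O) (ht : t ∈ O) (X Y Z : E3) :
    fderiv ℝ (fun s => formP u s Y Z) t X =
      formP u t (chr u t X Y) Z + formP u t Y (chr u t X Z) + covFormP u t X Y Z := by
  have hY := hu.isField_fderiv_const Y
  simp only [formP, covFormP]
  rw [hu.fderiv_g (hu.isField_P hY) (hu.isField_fderiv_const Z) ht, hu.nabla_P hY ht,
    nabla_fderiv_const, nabla_fderiv_const]
  simp only [P_add, g_add_left, g_add_right]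
  ring

theorem fderiv_formPJ (hu : IsLagrangianOn u O) (ht : t ∈ O) (X Y Z : E3) :
    fderiv ℝ (fun s => formPJ u s Y Z) t X =
      formPJ u t (chr u t X Y) Z + formPJ u t Y (chr u t X Z) + covFormPJ u t X Y Z := by
  have hY := hu.isField_fderiv_const Y
  simp only [formPJ, covFormPJ]
  rw [hu.fderiv_g (hu.isField_PJ hY) (hu.isField_fderiv_const Z) ht, hu.nabla_PJ hY ht,
    nabla_fderiv_const, nabla_fderiv_const]
  simp only [PJ_add, g_add_left, g_add_right]
  ring

theorem fderiv_formHG (hu : IsLagrangianOn u O) (ht : t ∈ O) (X Y Z W V : E3) :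
    fderiv ℝ (fun s => formHG u s Y Z W V) t X =
      formHG u t (chr u t X Y) Z W V + formHG u t Y (chr u t X Z) W V
      + formHG u t Y Z (chr u t X W) V + formHG u t Y Z W (chr u t X V)
      + covFormHG u t X Y Z W V := by
  have h1 := hu.fderiv_g_h_G ht X W V Y Z
  simp only [formHG, covFormHG, metr]
  rw [h1, nablaH, g_sub_left, g_sub_left]
  simp only [chr]
  ring

theorem fderiv_covCubic_explicit (hu : IsLagrangianOn u O) (hl : IsJIsotropicOn u O l)
    (ht : t ∈ O) (X Y Z W V : E3) :
    12 * fderiv ℝ (fun s => covCubic u s Y Z W V) t X =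
      12 * (covCubic u t Y (chr u t X Z) W V + covCubic u t Y Z (chr u t X W) V
        + covCubic u t Y Z W (chr u t X V) + covCubic u t (chr u t X Y) Z W V)
      + 4 * fderiv ℝ l t X * (metr u t Y Z * metr u t W V + metr u t Y W * metr u t V Z
        + metr u t Y V * metr u t Z W)
      - 2 * (covFormP u t X Y Z * formPJ u t W V + formP u t Y Z * covFormPJ u t X W V
        + (covFormP u t X Y W * formPJ u t V Z + formP u t Y W * covFormPJ u t X V Z)
        + (covFormP u t X Y V * formPJ u t Z W + formP u t Y V * covFormPJ u t X Z W))
      + 2 * (covFormPJ u t X Y Z * formP u t W V + formPJ u t Y Z * covFormP u t X W V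
        + (covFormPJ u t X Y W * formP u t V Z + formPJ u t Y W * covFormP u t X V Z)
        + (covFormPJ u t X Y V * formP u t Z W + formPJ u t Y V * covFormP u t X Z W))
      + 9 * covFormHG u t X Z W Y V - 3 * covFormHG u t X Y Z W V - 3 * covFormHG u t X Y W Z V := by
  have D := fun {f : E3 → ℝ} (hf : ContDiffOn ℝ ∞ f O) => hu.hasFDerivAt_of_contDiffOn ht hf
  have m := fun A B => D (hu.contDiffOn_metr A B)
  have p := fun A B => D (hu.contDiffOn_formP A B)
  have r := fun A B => D (hu.contDiffOn_formPJ A B)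
  have q := fun A B C E => D (hu.contDiffOn_formHG A B C E)
  have dl := D (hu.contDiffOn_of_isotropic hl)
  have h1 := (((((dl.const_mul 4).fun_mul
    ((((m Y Z).fun_mul (m W V)).fun_add ((m Y W).fun_mul (m V Z))).fun_add
      ((m Y V).fun_mul (m Z W)))).fun_sub
    (((((p Y Z).fun_mul (r W V)).fun_add ((p Y W).fun_mul (r V Z))).fun_add
      ((p Y V).fun_mul (r Z W))).const_mul 2)).fun_add
    (((((r Y Z).fun_mul (p W V)).fun_add ((r Y W).fun_mul (p V Z))).fun_add
      ((r Y V).fun_mul (p Z W))).const_mul 2)).fun_add ((q Z W Y V).const_mul 9)).fun_sub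
    ((q Y Z W V).const_mul 3) |>.fun_sub ((q Y W Z V).const_mul 3)
  have h2 := (D (hu.contDiffOn_covCubic Y Z W V)).const_mul 12
  have h3 := congrArg (fun L => L X) (h2.unique (h1.congr_of_eventuallyEq
    ((hu.eventually_mem ht).mono fun s hs => hu.covCubic_explicit hl hs Y Z W V)))
  simp only [_root_.add_apply, _root_.sub_apply, _root_.smul_apply, smul_eq_mul,
    hu.fderiv_metr ht, hu.fderiv_formP ht, hu.fderiv_formPJ ht, hu.fderiv_formHG ht] at h3
  rw [h3]
  -- The Christoffel terms produced by the product rule are the explicit formula itself with one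
  -- argument replaced by a Christoffel vector, so they regroup into values of `covCubic`.
  linear_combination -hu.covCubic_explicit hl ht Y (chr u t X Z) W V
    - hu.covCubic_explicit hl ht Y Z (chr u t X W) V - hu.covCubic_explicit hl ht Y Z W (chr u t X V)
    - hu.covCubic_explicit hl ht (chr u t X Y) Z W V

/-- The derivative of ∇C, skew-symmetrized in X and Y, is computed once from the explicit formula
and once from the Ricci identity; comparing the results gives the identity. -/
theorem isotropic_identity (hu : IsLagrangianOn u O) (hl : IsJIsotropicOn u O l)
    (ht : t ∈ O) (X Y Z W V : E3) :
      let x : HH := u t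
      let d : E3 → HH := fun A => fderiv ℝ u t A
      let Gd : E3 → E3 → HH := fun A B => G x (d A) (d B)
      12 * g x (normalCurv u (fun s => h u s Z W) t X Y
            - h u t (curv u t X Y Z) W - h u t Z (curv u t X Y W)) (J x (d V))
        + 9 * (g x (nablaH u t Y Z W) (Gd X V) - g x (nablaH u t X Z W) (Gd Y V))
        + 3 * g x (h u t Y Z) (J x (d W)) * g x (d X) (d V)
        - 3 * g x (h u t X Z) (J x (d W)) * g x (d Y) (d V)
        + cyc2 (fun Z W =>
            g x (h u t X Z) (J x (d V)) * g x (d Y) (d W)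
            - g x (h u t Y Z) (J x (d V)) * g x (d X) (d W)
            + g x (P x (d Y)) (d Z) * g x (P x (d X)) (Gd W V)
            - g x (P x (d X)) (d Z) * g x (P x (d Y)) (Gd W V)
            + g x (J x (P x (d Y))) (d Z) * g x (J x (P x (d X))) (Gd W V)
            - g x (J x (P x (d X))) (d Z) * g x (J x (P x (d Y))) (Gd W V)) Z W
        + 2 * termI u l t X Y Z W V = 0 := by
  intro x d Gd
  have s := hu.cubic_swap_left ht
  have r := hu.cubic_swap_right ht
  have E1 := hu.fderiv_covCubic_explicit hl ht X Y Z W V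
  have E2 := hu.fderiv_covCubic_explicit hl ht Y X Z W V
  have R := hu.fderiv_covCubic_sub ht X Y Z W V
  have N := hu.g_normalCurv_h ht X Y Z W V
  have K1 := hu.codazzi ht X Y Z (hu.isNormal_G ht W V)
  have K2 := hu.codazzi ht X Y W (hu.isNormal_G ht Z V)
  have K1' := hu.g_curvS ht X Y Z (hu.isNormal_G ht W V)
  have K2' := hu.g_curvS ht X Y W (hu.isNormal_G ht Z V)
  have c1 : cubic u t (curv u t X Y Z) W V = cubic u t W V (curv u t X Y Z) := by rw [s, r]
  have c2 : cubic u t Z (curv u t X Y W) V = cubic u t Z V (curv u t X Y W) := r _ _ _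
  have c3 : ∀ A, cubic u t Z W A = cubic u t A Z W := fun A => by rw [r, s]
  have c4 : ∀ A, cubic u t A W Z = cubic u t A Z W := fun A => r _ _ _
  -- Symmetry of the connection makes the terms with the Christoffel vector of X and Y in the first
  -- slot of ∇C cancel in the difference `E1 - E2`.
  rw [hu.chr_comm ht Y X] at E2
  simp only [covFormP, covFormPJ, covFormHG, c3, c4, metr_comm u t Y X] at E1 E2 N
  simp only [hu.h_comm ht Y X] at E2
  have hgoal : 12 * (g (u t) (normalCurv u (fun s => h u s Z W) t X Y) (J (u t) (fderiv ℝ u t V))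
      - cubic u t (curv u t X Y Z) W V - cubic u t Z (curv u t X Y W) V)
      + 9 * (g (u t) (nablaH u t Y Z W) (Gd X V) - g (u t) (nablaH u t X Z W) (Gd Y V))
      + 3 * cubic u t Y Z W * metr u t X V - 3 * cubic u t X Z W * metr u t Y V
      + cyc2 (fun Z W => cubic u t X Z V * metr u t Y W - cubic u t Y Z V * metr u t X W
          + formP u t Y Z * g x (P x (d X)) (Gd W V) - formP u t X Z * g x (P x (d Y)) (Gd W V)
          + g x (J x (P x (d Y))) (d Z) * g x (J x (P x (d X))) (Gd W V)
          - g x (J x (P x (d X))) (d Z) * g x (J x (P x (d Y))) (Gd W V)) Z W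
      + 2 * termI u l t X Y Z W V = 0 := by
    simp only [termI, cyc2, cyc3, x, d, Gd]
    simp only [formP, formPJ, metr] at *
    -- `N` replaces the action of R on V by normal curvature. The two g(h, G) terms with coefficient
    -- -3 yield differences of ∇h in X and Y paired with G(W, V) and G(Z, V), which Codazzi (`K1`,
    -- `K2`) turns into curvature. The coefficient 3 of g(h(Y, Z), JW) g(X, V) is 4 from the Ricci
    -- equation, -3 from the term with coefficient 9, and 2 from the other two.
    linear_combination E1 - E2 - 12 * R + 12 * N - 12 * c1 - 12 * c2 + 12 * c3 (curv u t X Y V)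
      - 3 * K1 - 3 * K2 - K1' - K2'
  rw [g_sub_left, g_sub_left]
  exact hgoal

end IsLagrangianOn

/-! ### Passing to charts -/

/-- The inclusion of `𝕊³ × 𝕊³` in `ℍ × ℍ`. -/
def inclHH (y : S3 × S3) : HH := (y.1, y.2)

theorem contMDiff_inclHH : ContMDiff ((𝓡 3).prod (𝓡 3)) 𝓘(ℝ, HH) ∞ inclHH :=
  (contMDiff_coe_sphere.comp contMDiff_fst).prodMk_space (contMDiff_coe_sphere.comp contMDiff_snd)

/-- The two components of the derivative are the derivatives of the sphere inclusions, each of which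
is injective. -/
theorem mfderiv_inclHH_injective (y : S3 × S3) :
    Function.Injective (mfderiv ((𝓡 3).prod (𝓡 3)) 𝓘(ℝ, HH) inclHH y) := by
  have hc : ∀ v : S3, MDifferentiableAt (𝓡 3) 𝓘(ℝ, ℍ[ℝ]) ((↑) : S3 → ℍ[ℝ]) v := fun v =>
    contMDiff_coe_sphere.mdifferentiableAt (n := 1) (by norm_num)
  have h1 : mfderiv ((𝓡 3).prod (𝓡 3)) 𝓘(ℝ, ℍ[ℝ]) (fun y : S3 × S3 => (y.1 : ℍ[ℝ])) y =
      (mfderiv (𝓡 3) 𝓘(ℝ, ℍ[ℝ]) ((↑) : S3 → ℍ[ℝ]) y.1).comp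
        (ContinuousLinearMap.fst ℝ (TangentSpace (𝓡 3) y.1) (TangentSpace (𝓡 3) y.2)) := by
    rw [← mfderiv_fst]
    exact mfderiv_comp y (hc y.1) mdifferentiableAt_fst
  have h2 : mfderiv ((𝓡 3).prod (𝓡 3)) 𝓘(ℝ, ℍ[ℝ]) (fun y : S3 × S3 => (y.2 : ℍ[ℝ])) y =
      (mfderiv (𝓡 3) 𝓘(ℝ, ℍ[ℝ]) ((↑) : S3 → ℍ[ℝ]) y.2).comp
        (ContinuousLinearMap.snd ℝ (TangentSpace (𝓡 3) y.1) (TangentSpace (𝓡 3) y.2)) := by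
    rw [← mfderiv_snd]
    exact mfderiv_comp y (hc y.2) mdifferentiableAt_snd
  have hi := contMDiff_inclHH.mdifferentiableAt (x := y) (by simp)
  have k1 : ∀ w, (mfderiv ((𝓡 3).prod (𝓡 3)) 𝓘(ℝ, HH) inclHH y w : HH).1 =
      mfderiv (𝓡 3) 𝓘(ℝ, ℍ[ℝ]) ((↑) : S3 → ℍ[ℝ]) y.1 w.1 := fun w => by
    have e := mfderiv_comp y (g := ContinuousLinearMap.fst ℝ ℍ[ℝ] ℍ[ℝ])
      (ContinuousLinearMap.mdifferentiableAt _) hi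
    rw [ContinuousLinearMap.mfderiv_eq] at e
    exact (DFunLike.congr_fun e w).symm.trans (DFunLike.congr_fun h1 w)
  have k2 : ∀ w, (mfderiv ((𝓡 3).prod (𝓡 3)) 𝓘(ℝ, HH) inclHH y w : HH).2 =
      mfderiv (𝓡 3) 𝓘(ℝ, ℍ[ℝ]) ((↑) : S3 → ℍ[ℝ]) y.2 w.2 := fun w => by
    have e := mfderiv_comp y (g := ContinuousLinearMap.snd ℝ ℍ[ℝ] ℍ[ℝ])
      (ContinuousLinearMap.mdifferentiableAt _) hi
    rw [ContinuousLinearMap.mfderiv_eq] at e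
    exact (DFunLike.congr_fun e w).symm.trans (DFunLike.congr_fun h2 w)
  have inj : ∀ v : S3, Function.Injective (mfderiv (𝓡 3) 𝓘(ℝ, ℍ[ℝ]) ((↑) : S3 → ℍ[ℝ]) v) :=
    fun v => by convert! injective_mvfderiv_subtypeVal_sphere v
  intro w w' hww
  exact Prod.ext (inj _ ((k1 w).symm.trans ((congrArg Prod.fst hww).trans (k1 w'))))
    (inj _ ((k2 w).symm.trans ((congrArg Prod.snd hww).trans (k2 w'))))

section Charts

variable {M : Type*} [TopologicalSpace M] [ChartedSpace E3 M]

theorem IsSmoothImmersion.contMDiff_toHH {f : M → S3 × S3} (hf : IsSmoothImmersion f) :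
    ContMDiff (𝓡 3) 𝓘(ℝ, HH) ∞ (toHH f) := contMDiff_inclHH.comp hf.1

theorem IsSmoothImmersion.mfderiv_toHH_injective {f : M → S3 × S3} (hf : IsSmoothImmersion f)
    (p : M) : Function.Injective (mfderiv (𝓡 3) 𝓘(ℝ, HH) (toHH f) p) := by
  have e : mfderiv (𝓡 3) 𝓘(ℝ, HH) (toHH f) p =
      (mfderiv ((𝓡 3).prod (𝓡 3)) 𝓘(ℝ, HH) inclHH (f p)).comp
        (mfderiv (𝓡 3) ((𝓡 3).prod (𝓡 3)) f p) :=
    mfderiv_comp p (contMDiff_inclHH.mdifferentiableAt (by simp)) (hf.1.mdifferentiableAt (by simp))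
  rw [e]
  exact (mfderiv_inclHH_injective _).comp (hf.2 p)

variable [IsManifold (𝓡 3) ∞ M]

/-- The derivative of the local parametrization given by a chart is the derivative of the immersion
up to a change of variables. -/
theorem IsSmoothImmersion.exists_fderiv_param {f : M → S3 × S3} (hf : IsSmoothImmersion f)
    {φ : OpenPartialHomeomorph M E3} (hφ : φ ∈ atlas E3 M) {t : E3} (ht : t ∈ φ.target) :
    ∃ e : E3 → TangentSpace (𝓡 3) (φ.symm t), Function.Bijective e ∧
      ∀ X, fderiv ℝ (param f φ) t X = mfderiv (𝓡 3) 𝓘(ℝ, HH) (toHH f) (φ.symm t) (e X) := by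
  have : IsManifold (𝓡 3) 1 M := .of_le (n := ∞) (by norm_cast)
  have hm := mdifferentiable_of_mem_atlas (I := 𝓡 3) hφ
  refine ⟨mfderiv (𝓡 3) (𝓡 3) φ.symm t, hm.symm.mfderiv_bijective ht, fun X => ?_⟩
  rw [← mfderiv_eq_fderiv]
  have := mfderiv_comp (I := 𝓡 3) (I' := 𝓡 3) (I'' := 𝓘(ℝ, HH)) t (g := toHH f) (f := φ.symm)
    (hf.contMDiff_toHH.mdifferentiableAt (by simp)) (hm.mdifferentiableAt_symm ht)
  exact DFunLike.congr_fun this X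

/-- The Lagrangian condition only involves the set of tangent vectors, so it transfers along the
bijective change of variables given by the chart. -/
theorem isLagrangianOn_param {f : M → S3 × S3} (hf : IsSmoothImmersion f) (hL : IsLagrangian f)
    {φ : OpenPartialHomeomorph M E3} (hφ : φ ∈ atlas E3 M) :
    IsLagrangianOn (param f φ) φ.target where
  isOpen := φ.open_target
  smooth := (hf.contMDiff_toHH.comp_contMDiffOn (contMDiffOn_symm_of_mem_maximalAtlas
    (IsManifold.subset_maximalAtlas hφ))).contDiffOn
  onS s _ := ⟨by simp [param, toHH], by simp [param, toHH]⟩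
  injective s hs := by
    obtain ⟨e, he, h⟩ := hf.exists_fderiv_param hφ hs
    intro X Y hXY
    rw [h, h] at hXY
    exact he.1 (hf.mfderiv_toHH_injective _ hXY)
  lagrangian s hs w hw := by
    obtain ⟨e, he, h⟩ := hf.exists_fderiv_param hφ hs
    refine Iff.trans ?_ ((hL (φ.symm s) w hw).trans ?_)
    · simp only [h]
      exact ⟨fun ⟨X, hX⟩ => ⟨e X, hX⟩, fun ⟨Y, hY⟩ => by
        obtain ⟨X, rfl⟩ := he.2 Y
        exact ⟨X, hY⟩⟩
    · simp only [h]
      exact ⟨fun H X => H (e X), fun H Y => by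
        obtain ⟨X, rfl⟩ := he.2 Y
        exact H X⟩

theorem contMDiff_of_isJIsotropic {f : M → S3 × S3} (hf : IsSmoothImmersion f)
    (hL : IsLagrangian f) {lam : M → ℝ} (hJ : IsJIsotropic f lam) :
    ContMDiff (𝓡 3) 𝓘(ℝ, ℝ) ∞ lam := by
  intro p
  have hφ := chart_mem_atlas E3 p
  have h1 : ContDiffOn ℝ ∞ (lam ∘ (chartAt E3 p).symm) (chartAt E3 p).target :=
    (isLagrangianOn_param hf hL hφ).contDiffOn_of_isotropic (hJ _ hφ)
  have h2 := h1.contMDiffOn.comp (contMDiffOn_of_mem_maximalAtlas (I := 𝓡 3) (n := ∞)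
    (IsManifold.subset_maximalAtlas hφ)) (chartAt E3 p).mapsTo
  have h3 : ContMDiffOn (𝓡 3) 𝓘(ℝ, ℝ) ∞ lam (chartAt E3 p).source :=
    h2.congr fun q hq => by simp [(chartAt E3 p).left_inv hq]
  exact h3.contMDiffAt ((chartAt E3 p).open_source.mem_nhds (mem_chart_source E3 p))

end Charts

end NK

end

/-! ### The theorem -/

open NK in
theorem proposition4p2 {M : Type*} [TopologicalSpace M] [ChartedSpace E3 M]
    [IsManifold (𝓡 3) ∞ M] (f : M → S3 × S3) (hf : IsSmoothImmersion f) (hL : IsLagrangian f)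
    (lam : M → ℝ) (hJ : IsJIsotropic f lam) :
    ContMDiff (𝓡 3) 𝓘(ℝ, ℝ) ∞ lam ∧
    ∀ φ ∈ atlas E3 M, ∀ t ∈ φ.target, ∀ X Y Z W V : E3,
      let u : E3 → HH := param f φ
      let x : HH := u t
      let d : E3 → HH := fun A => fderiv ℝ u t A
      let Gd : E3 → E3 → HH := fun A B => G x (d A) (d B)
      12 * g x (normalCurv u (fun s => h u s Z W) t X Y
            - h u t (curv u t X Y Z) W - h u t Z (curv u t X Y W)) (J x (d V))
        + 9 * (g x (nablaH u t Y Z W) (Gd X V) - g x (nablaH u t X Z W) (Gd Y V))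
        + 3 * g x (h u t Y Z) (J x (d W)) * g x (d X) (d V)
        - 3 * g x (h u t X Z) (J x (d W)) * g x (d Y) (d V)
        + cyc2 (fun Z W =>
            g x (h u t X Z) (J x (d V)) * g x (d Y) (d W)
            - g x (h u t Y Z) (J x (d V)) * g x (d X) (d W)
            + g x (P x (d Y)) (d Z) * g x (P x (d X)) (Gd W V)
            - g x (P x (d X)) (d Z) * g x (P x (d Y)) (Gd W V)
            + g x (J x (P x (d Y))) (d Z) * g x (J x (P x (d X))) (Gd W V)
            - g x (J x (P x (d X))) (d Z) * g x (J x (P x (d Y))) (Gd W V)) Z W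
        + 2 * termI u (lam ∘ φ.symm) t X Y Z W V = 0 :=
  ⟨contMDiff_of_isJIsotropic hf hL hJ, fun _ hφ _ ht X Y Z W V =>
    (isLagrangianOn_param hf hL hφ).isotropic_identity (hJ _ hφ) ht X Y Z W V⟩
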